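/- Let $R$ be an irreducible, reduced, finite (crystallographic) root system in a finite-dimensional $\mathbb Q$-vector space $V$, with a chosen set $\Pi$ of simple roots, corresponding positive roots $R^+$ and highest root $\tilde\alpha$, and let $X=\{\lambda\in V:\langle\lambda,\alpha^\vee\rangle\in\mathbb Z\ \forall\alpha\in R\}$ be its weight lattice. Let $\widehat{\mathcal W}$ be the affine Weyl group, i.e. the group of transformations of $V^*$ generated by the reflections $s_{\alpha,n}(v)=v-(\langle\alpha,v\rangle-n)\alpha^\vee$ ($\alpha\in R$, $n\in\mathbb Z$). It acts linearly on $V^*\oplus\mathbb Q$ by extending $w(v,1)=(wv,1)$ (fixing the second coordinate), dually on $V\oplus\mathbb Q$, and hence on $\widehat X=X\oplus\mathbb Z$. The affine roots are $\widehat R=\{(\alpha,n):\alpha\in R,\ n\in\mathbb Z\}\subset\widehat X$, with $s_{(\alpha,-n)}:=s_{\alpha,n}$; the positive ones are $\widehat R^+=\{(\alpha,n):n>0\}\cup\{(\alpha,0):\alpha\in R^+\}$ and the simple ones are $\widehat\Pi=\{(\alpha,0):\alpha\in\Pi\}\cup\{(-\tilde\alpha,1)\}$. Put $\widehat{\mathcal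 S}=\{s_\gamma:\gamma\in\widehat\Pi\}$, and let $\le$ be the Bruhat order of the Coxeter system $(\widehat{\mathcal W},\widehat{\mathcal S})$. Let $\mathbb F$ be a field of characteristic different from $2$, $S$ the symmetric algebra of the $\mathbb F$-vector space $\widehat X\otimes_{\mathbb Z}\mathbb F$, and $\bar\lambda=\lambda\otimes1$ for $\lambda\in\widehat X$. Let $\widehat{\mathcal G}$ be the moment graph with vertex set $\widehat{\mathcal W}$ and an edge $y\to x$ with label $\bar\gamma$ whenever $y<x$ and $x=s_\gamma y$ with $\gamma\in\widehat R^+$. For $\mathcal I\subset\widehat{\mathcal W}$, the full subgraph $\widehat{\mathcal G}_{\mathcal I}$ satisfies the GKM-property if the labels of any two distinct edges of it having a common vertex are not proportional over $\mathbb F$. For a sequence $\mathbf s=(s_1,\dots,s_l)$ in $\widehat{\mathcal S}$, let $I(\mathbf s)$ be the set of its $2^l$ subsequences (replace some entries by a blank), let $\mathrm{ev}(\sigma)\in\widehat{\mathcal W}$ be the ordered product of the non-blank entries of $\sigma\in I(\mathbf s)$, and put $I(\mathbf s)_x=\{\sigma\in I(\mathbf s):\mathrm{ev}(\sigma)=x\}$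 and $J(\mathbf s)=\{\mathrm{ev}(\sigma):\sigma\in I(\mathbf s)\}$. Write $\mathbf s'$, $\sigma'$ for the sequences with the last entry omitted. Define $S$-submodules $\mathcal X(\mathbf s)\subset\bigoplus_{\sigma\in I(\mathbf s)}S$ by $\mathcal X(\emptyset)=S$ and, for $l\ge1$, $$\mathcal X(\mathbf s)=\Delta(\mathcal X(\mathbf s'))+c^{\alpha_l}\Delta(\mathcal X(\mathbf s')),\qquad \Delta(f)_\sigma=f_{\sigma'},\qquad (c^{\lambda}f)_\sigma=\overline{\mathrm{ev}(\sigma)(\lambda)}\,f_\sigma,$$ where $\alpha_l\in\widehat\Pi$ is the simple affine root with $s_l=s_{\alpha_l}$. Corollary 3. Let $\mathbf s$ be a sequence in $\widehat{\mathcal S}$ such that $\widehat{\mathcal G}_{J(\mathbf s)}$ satisfies the GKM-property. Suppose that $y\xrightarrow{\ \alpha\ }x$ is an edge of $\widehat{\mathcal G}$ and that $f\in\mathcal X(\mathbf s)$ satisfies $f|_{I(\mathbf s)_y}=0$. Then there is $g\in\mathcal X(\mathbf s)$ such that $f|_{I(\mathbf s)_x}=\alpha\,g|_{I(\mathbf s)_x}$.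 -/

import Mathlib

open scoped TensorProduct

/-! ### Moment graphs -/

/-- A moment graph over a vector space `W` over `K`, with set of vertices `V` and set of oriented
edges `E`: every edge goes from `src` to `tgt`, has a nonzero label in `W`, and goes upwards in a
given partial order on the vertices. -/
structure MomentGraph (K W V E : Type*) [Field K] [AddCommGroup W] [Module K W] where
  order : PartialOrder V
  src : E → V
  tgt : E → V
  label : E → W
  label_ne_zero : ∀ e, label e ≠ 0
  src_lt_tgt : ∀ e, order.lt (src e) (tgt e)

namespace MomentGraph

variable {K W V E : Type*} [Field K] [AddCommGroup W] [Module K W]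

/-- The vertex `x` lies on the edge `e`. -/
def Incident (G : MomentGraph K W V E) (x : V) (e : E) : Prop := x = G.src e ∨ x = G.tgt e

/-- The GKM-property: the labels of any two (distinct) edges having a common vertex are not
proportional. -/
def GKM (G : MomentGraph K W V E) : Prop :=
  ∀ e e' : E, e ≠ e' → (∃ x, G.Incident x e ∧ G.Incident x e') →
    G.label e' ∉ Submodule.span K {G.label e}

/-- The full moment subgraph with set of vertices `I`: its edges are the edges connecting elements
of `I`. -/
def full (G : MomentGraph K W V E) (I : Set V) :
    MomentGraph K W I {e : E // G.src e ∈ I ∧ G.tgt e ∈ I} where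
  order := @Subtype.partialOrder V G.order (· ∈ I)
  src e := ⟨G.src e.1, e.2.1⟩
  tgt e := ⟨G.tgt e.1, e.2.2⟩
  label e := G.label e.1
  label_ne_zero e := G.label_ne_zero e.1
  src_lt_tgt e := G.src_lt_tgt e.1

end MomentGraph

noncomputable section

namespace AffineWeyl

/-! ### The affine Weyl group and its action on affine weights

`P` is a root system in the rational vector space `V`, and `V'` is the dual space of `V` (identified
through the perfect pairing of `P`).  The roots are indexed by `ι`. -/

variable {ι V V' : Type*} [AddCommGroup V] [Module ℚ V] [AddCommGroup V'] [Module ℚ V']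

section Group

variable (P : RootPairing ι ℚ V V')

/-- The affine reflection `s_{α,n}` of `V'`, where `α` is the `i`-th root:
`s_{α,n}(v) = v - (⟨α, v⟩ - n) α^∨`. -/
def reflection (i : ι) (n : ℤ) : V' ≃ᵃ[ℚ] V' :=
  (P.coreflection i).toAffineEquiv.trans (AffineEquiv.constVAdd ℚ V' ((n : ℚ) • P.coroot i))

theorem reflection_apply (i : ι) (n : ℤ) (v : V') :
    reflection P i n v = v - (P.toLinearMap (P.root i) v - n) • P.coroot i := by
  simp [reflection, RootPairing.coreflection_apply, sub_smul]
  abel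

theorem reflection_mul_self (i : ι) (n : ℤ) : reflection P i n * reflection P i n = 1 := by
  ext v
  have h : P.toLinearMap (P.root i) (P.coroot i) = 2 := P.root_coroot_two i
  simp only [AffineEquiv.mul_def, AffineEquiv.trans_apply, reflection_apply, map_sub, map_smul, h,
    smul_eq_mul, AffineEquiv.one_def, AffineEquiv.refl_apply]
  module

/-- The affine Weyl group, generated by all affine reflections `s_{α,n}`. -/
def weylGroup : Subgroup (V' ≃ᵃ[ℚ] V') :=
  Subgroup.closure (Set.range fun p : ι × ℤ => reflection P p.1 p.2)

/-- The pairing between `V ⊕ ℚ` and `V' ⊕ ℚ`. -/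
def hatPairing (a : V × ℚ) (v : V' × ℚ) : ℚ := P.toLinearMap a.1 v.1 + a.2 * v.2

/-- The linear extension to `V' ⊕ ℚ` of an affine transformation `g` of `V'`: the linear map that
fixes the second coordinate and sends `(v, 1)` to `(g v, 1)`. -/
def linearize (g : V' ≃ᵃ[ℚ] V') (v : V' × ℚ) : V' × ℚ := (g.linear v.1 + v.2 • g 0, v.2)

/-- The dual action on `V ⊕ ℚ`, characterized by `⟨g a, v⟩ = ⟨a, g⁻¹ v⟩`
(see `hatPairing_dualAct`). -/
def dualAct (g : V' ≃ᵃ[ℚ] V') : V × ℚ →ₗ[ℚ] V × ℚ :=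
  LinearMap.prod
    (P.toLinearMap.toPerfPair.symm.toLinearMap ∘ₗ (g⁻¹).linear.toLinearMap.dualMap ∘ₗ
      P.toLinearMap.toPerfPair.toLinearMap ∘ₗ LinearMap.fst ℚ V ℚ)
    (LinearMap.snd ℚ V ℚ + P.toLinearMap.flip (g⁻¹ 0) ∘ₗ LinearMap.fst ℚ V ℚ)

theorem hatPairing_dualAct (g : V' ≃ᵃ[ℚ] V') (a : V × ℚ) (v : V' × ℚ) :
    hatPairing P (dualAct P g a) v = hatPairing P a (linearize g⁻¹ v) := by
  simp [hatPairing, linearize, dualAct]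
  ring

theorem hatPairing_ext {a a' : V × ℚ} (h : ∀ v, hatPairing P a v = hatPairing P a' v) :
    a = a' := by
  have h1 : a.1 = a'.1 := by
    apply P.toLinearMap.toPerfPair.injective
    ext v
    simpa [hatPairing] using h (v, 0)
  have h2 : a.2 = a'.2 := by simpa [hatPairing] using h (0, 1)
  exact Prod.ext h1 h2

theorem linearize_mul (g h : V' ≃ᵃ[ℚ] V') (v : V' × ℚ) :
    linearize (g * h) v = linearize g (linearize h v) := by
  have key : g (h 0) = g.linear (h 0) + g 0 := by
    simpa using g.map_vadd 0 (h 0)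
  have hl : (g * h).linear v.1 = g.linear (h.linear v.1) := rfl
  simp only [linearize, hl, AffineEquiv.coe_mul, Function.comp_apply, key, map_add, map_smul]
  ext
  · simp only [smul_add]; abel
  · rfl

theorem dualAct_mul (g h : V' ≃ᵃ[ℚ] V') (a : V × ℚ) :
    dualAct P (g * h) a = dualAct P g (dualAct P h a) := by
  apply hatPairing_ext P
  intro v
  simp only [hatPairing_dualAct, mul_inv_rev, linearize_mul]

theorem dualAct_one (a : V × ℚ) : dualAct P 1 a = a := by
  apply hatPairing_ext P
  intro v
  rw [hatPairing_dualAct, inv_one]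
  simp [linearize, AffineEquiv.one_def]

theorem reflection_inv (i : ι) (n : ℤ) : (reflection P i n)⁻¹ = reflection P i n :=
  inv_eq_of_mul_eq_one_left (reflection_mul_self P i n)

theorem dualAct_reflection (i : ι) (n : ℤ) (a : V × ℚ) :
    dualAct P (reflection P i n) a =
      (P.reflection i a.1, a.2 + n * P.toLinearMap a.1 (P.coroot i)) := by
  apply hatPairing_ext P
  intro v
  rw [hatPairing_dualAct, reflection_inv]
  have hl : (reflection P i n).linear v.1 = P.coreflection i v.1 := rfl
  simp only [hatPairing, linearize, hl, reflection_apply, RootPairing.coreflection_apply,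
    RootPairing.reflection_apply, map_add, map_sub, map_smul, map_zero, smul_eq_mul,
    LinearMap.sub_apply, LinearMap.smul_apply, RootPairing.root', RootPairing.coroot',
    LinearMap.flip_apply]
  simp
  ring

/-- The affine weights `X ⊕ ℤ`, where `X` is the weight lattice of `P`. -/
def weights : AddSubgroup (V × ℚ) where
  carrier := {a | (∀ i, ∃ k : ℤ, P.toLinearMap a.1 (P.coroot i) = k) ∧ ∃ k : ℤ, a.2 = k}
  zero_mem' := ⟨fun _ => ⟨0, by simp⟩, ⟨0, by simp⟩⟩
  add_mem' := by
    rintro a a' ⟨h, k, hk⟩ ⟨h', k', hk'⟩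
    refine ⟨fun i => ?_, k + k', by simp [hk, hk']⟩
    obtain ⟨m, hm⟩ := h i
    obtain ⟨m', hm'⟩ := h' i
    exact ⟨m + m', by simp [hm, hm']⟩
  neg_mem' := by
    rintro a ⟨h, k, hk⟩
    refine ⟨fun i => ?_, -k, by simp [hk]⟩
    obtain ⟨m, hm⟩ := h i
    exact ⟨-m, by simp [hm]⟩

/-- The affine root `(α, n)`, where `α` is the `i`-th root, is encoded by the pair `(i, n)`; this is
the corresponding vector of `V ⊕ ℚ`. -/
def rootVec (γ : ι × ℤ) : V × ℚ := (P.root γ.1, (γ.2 : ℚ))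

/-- The reflection `s_γ` of the affine Weyl group for an affine root `γ`:
`s_{(α,-n)} = s_{α,n}`. -/
def affineReflection (γ : ι × ℤ) : weylGroup P :=
  ⟨reflection P γ.1 (-γ.2), Subgroup.subset_closure ⟨(γ.1, -γ.2), rfl⟩⟩

variable [P.IsCrystallographic]

theorem dualAct_reflection_mem (i : ι) (n : ℤ) {a : V × ℚ} (ha : a ∈ weights P) :
    dualAct P (reflection P i n) a ∈ weights P := by
  obtain ⟨h, k, hk⟩ := ha
  obtain ⟨m, hm⟩ := h i
  rw [dualAct_reflection]
  refine ⟨fun j => ?_, k + n * m, by simp [hk, hm]⟩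
  obtain ⟨m', hm'⟩ := h j
  obtain ⟨q, hq⟩ := P.exists_value (S := ℤ) i j
  refine ⟨m' - m * q, ?_⟩
  have hq' : P.toLinearMap (P.root i) (P.coroot j) = q := by simpa using hq.symm
  have h1 : P.coroot' i a.1 = m := hm
  simp [RootPairing.reflection_apply, h1, hm', hq']

theorem dualAct_mem {g : V' ≃ᵃ[ℚ] V'} (hg : g ∈ weylGroup P) :
    ∀ a ∈ weights P, dualAct P g a ∈ weights P := by
  suffices h : (∀ a ∈ weights P, dualAct P g a ∈ weights P) ∧
      ∀ a ∈ weights P, dualAct P g⁻¹ a ∈ weights P from h.1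
  induction hg using Subgroup.closure_induction with
  | mem g hg =>
    obtain ⟨p, rfl⟩ := hg
    simp only [reflection_inv]
    exact ⟨fun a => dualAct_reflection_mem P _ _, fun a => dualAct_reflection_mem P _ _⟩
  | one =>
    simp only [inv_one, dualAct_one]
    exact ⟨fun a h => h, fun a h => h⟩
  | mul g h _ _ ihg ihh =>
    simp only [mul_inv_rev, dualAct_mul]
    exact ⟨fun a ha => ihg.1 _ (ihh.1 a ha), fun a ha => ihh.2 _ (ihg.2 a ha)⟩
  | inv g _ ih =>
    rw [inv_inv]
    exact ⟨ih.2, ih.1⟩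

theorem rootVec_mem (γ : ι × ℤ) : rootVec P γ ∈ weights P := by
  refine ⟨fun j => ?_, γ.2, rfl⟩
  obtain ⟨q, hq⟩ := P.exists_value (S := ℤ) γ.1 j
  exact ⟨q, by simpa [rootVec] using hq.symm⟩

/-- The action of the affine Weyl group on the affine weights. -/
def act (w : weylGroup P) (a : weights P) : weights P :=
  ⟨dualAct P w.1 a.1, dualAct_mem P w.2 a.1 a.2⟩

/-- The affine root `γ` as an affine weight. -/
def rootWeight (γ : ι × ℤ) : weights P := ⟨rootVec P γ, rootVec_mem P γ⟩

end Group

/-! ### Coxeter structure -/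

section Coxeter

variable {P : RootPairing ι ℚ V V'} (b : P.Base)

/-- Positive affine roots: `(α, n)` with `n > 0`, and `(α, 0)` with `α` positive. -/
def IsPosRoot (γ : ι × ℤ) : Prop := 0 < γ.2 ∨ (γ.2 = 0 ∧ b.IsPos γ.1)

/-- The `i`-th root is the highest root: its difference with any root is a sum of simple roots. -/
def IsHighest (i : ι) : Prop :=
  ∀ j, P.root i - P.root j ∈ AddSubmonoid.closure (P.root '' b.support)

/-- Simple affine roots: `(α, 0)` with `α` simple, and `(-α, 1)` with `α` the highest root. -/
def IsSimpleRoot (γ : ι × ℤ) : Prop :=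
  (γ.2 = 0 ∧ γ.1 ∈ b.support) ∨
    (γ.2 = 1 ∧ ∃ i, IsHighest b i ∧ P.root γ.1 = -P.root i)

/-- The type of simple affine roots. -/
abbrev SimpleRoot : Type _ := {γ : ι × ℤ // IsSimpleRoot b γ}

/-- The simple reflection corresponding to a simple affine root. -/
def simpleReflection (γ : SimpleRoot b) : weylGroup P := affineReflection P γ.1

/-- The length of an element of the affine Weyl group: the least length of an expression as a
product of simple reflections. -/
def length (w : weylGroup P) : ℕ :=
  sInf {k | ∃ L : List (SimpleRoot b), L.length = k ∧ (L.map (simpleReflection b)).prod = w}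

/-- The reflections of the Coxeter group: the conjugates of the simple reflections. -/
def reflections : Set (weylGroup P) :=
  {t | ∃ (w : weylGroup P) (γ : SimpleRoot b), t = w * simpleReflection b γ * w⁻¹}

/-- The relation generating the Bruhat order: `w = u t` for a reflection `t`, and `u` is shorter
than `w`. -/
def BruhatStep (u w : weylGroup P) : Prop :=
  length b u < length b w ∧ u⁻¹ * w ∈ reflections b

theorem eq_or_length_lt {u w : weylGroup P} (h : Relation.ReflTransGen (BruhatStep b) u w) :
    u = w ∨ length b u < length b w := by
  induction h with
  | refl => exact Or.inl rfl
  | tail _ h ih =>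
    rcases ih with rfl | ih
    · exact Or.inr h.1
    · exact Or.inr (ih.trans h.1)

/-- The Bruhat order on the affine Weyl group. -/
@[reducible] def bruhatOrder : PartialOrder (weylGroup P) where
  le := Relation.ReflTransGen (BruhatStep b)
  le_refl _ := Relation.ReflTransGen.refl
  le_trans _ _ _ := Relation.ReflTransGen.trans
  le_antisymm u w h h' := by
    rcases eq_or_length_lt b h with h1 | h1
    · exact h1
    · rcases eq_or_length_lt b h' with h2 | h2
      · exact h2.symm
      · exact absurd h1 (lt_asymm h2)

end Coxeter

/-! ### The moment graph of the affine Weyl group -/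

section Graph

variable (F : Type*) [Field F]

/-- The `F`-vector space obtained from the affine weights by extension of scalars. -/
abbrev WeightSpace (P : RootPairing ι ℚ V V') : Type _ := F ⊗[ℤ] weights P

/-- The image `1 ⊗ a` of an affine weight `a` in the weight space over `F`. -/
def bar (P : RootPairing ι ℚ V V') (a : weights P) : WeightSpace F P := (1 : F) ⊗ₜ[ℤ] a

/-- The symmetric algebra of the weight space over `F`. -/
abbrev Sym (P : RootPairing ι ℚ V V') : Type _ := SymmetricAlgebra F (WeightSpace F P)

/-- An element of the weight space as an element of the symmetric algebra. -/
def inc (P : RootPairing ι ℚ V V') (a : WeightSpace F P) : Sym F P := SymmetricAlgebra.ι F _ a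

variable {P : RootPairing ι ℚ V V'} [P.IsCrystallographic]

theorem bar_rootWeight_ne_zero [NeZero (2 : F)] (γ : ι × ℤ) :
    bar F P (rootWeight P γ) ≠ 0 := by
  have hz : ∀ a : weights P, ∃ k : ℤ, P.toLinearMap a.1.1 (P.coroot γ.1) = k :=
    fun a => a.2.1 γ.1
  choose c hc using hz
  let φ : weights P →+ ℤ :=
    { toFun := c
      map_zero' := by
        have h := hc 0
        simp only [ZeroMemClass.coe_zero, Prod.fst_zero, map_zero, LinearMap.zero_apply] at h
        exact_mod_cast h.symm
      map_add' := fun x y => by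
        have h := hc (x + y)
        simp only [AddSubgroup.coe_add, Prod.fst_add, map_add, LinearMap.add_apply, hc] at h
        exact_mod_cast h.symm }
  intro h0
  have h1 := congrArg (TensorProduct.rid ℤ F ∘ LinearMap.lTensor F φ.toIntLinearMap) h0
  have h2 : φ (rootWeight P γ) = 2 := by
    have h := hc (rootWeight P γ)
    have h' : P.toLinearMap (rootWeight P γ).1.1 (P.coroot γ.1) = 2 := P.root_coroot_two γ.1
    rw [h'] at h
    exact_mod_cast h.symm
  simp [bar, h2] at h1
  exact two_ne_zero h1

/-- The edges of the moment graph: triples `(x, y, α)` with `α` a positive affine root, `x < y` and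
`y = s_α x`.  Here `α` is determined by `x` and `y`. -/
abbrev Edge (b : P.Base) : Type _ :=
  {e : weylGroup P × weylGroup P × (ι × ℤ) //
    IsPosRoot b e.2.2 ∧ (bruhatOrder b).lt e.1 e.2.1 ∧ e.2.1 = affineReflection P e.2.2 * e.1}

/-- The moment graph over `F` of the affine Weyl group, with its Bruhat order. -/
def momentGraph [NeZero (2 : F)] (b : P.Base) :
    MomentGraph F (WeightSpace F P) (weylGroup P) (Edge b) where
  order := bruhatOrder b
  src e := e.1.1
  tgt e := e.1.2.1
  label e := bar F P (rootWeight P e.1.2.2)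
  label_ne_zero e := bar_rootWeight_ne_zero F e.1.2.2
  src_lt_tgt e := e.2.2.1

end Graph

/-! ### Sequences of simple reflections and the modules attached to them

A sequence of simple reflections is given by the sequence `s : Fin l → SimpleRoot b` of the
corresponding simple affine roots.  A subsequence `σ : Fin l → Bool` keeps the entries at which `σ`
is true and replaces the others by the blank symbol.  Its truncation, obtained by omitting the last
entry, is `Fin.init σ`. -/

section Sequences

variable {P : RootPairing ι ℚ V V'} {b : P.Base}

/-- The product of the entries of the subsequence `σ` of `s`, in their order and ignoring blanks. -/
def ev {l : ℕ} (s : Fin l → SimpleRoot b) (σ : Fin l → Bool) : weylGroup P :=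
  (List.ofFn fun i => if σ i then simpleReflection b (s i) else 1).prod

/-- The set of products of all subsequences of `s`. -/
def products {l : ℕ} (s : Fin l → SimpleRoot b) : Set (weylGroup P) := Set.range (ev s)

/-- The set of subsequences of `s` with product `x`. -/
def subseqs {l : ℕ} (s : Fin l → SimpleRoot b) (x : weylGroup P) : Set (Fin l → Bool) :=
  {σ | ev s σ = x}

variable (F : Type*) [Field F]

/-- The diagonal embedding `Δ(f)_σ = f_{σ'}`, where `σ'` is the truncation of `σ`. -/
def diag (P : RootPairing ι ℚ V V') (l : ℕ) :
    ((Fin l → Bool) → Sym F P) →ₗ[Sym F P] ((Fin (l + 1) → Bool) → Sym F P) :=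
  LinearMap.funLeft (Sym F P) (Sym F P) Fin.init

variable [P.IsCrystallographic]

/-- Multiplication by the element `c^a` for an affine weight `a`: the component at `σ` is multiplied
by the image of `x(a)`, where `x` is the product of `σ`. -/
def weightMul {l : ℕ} (s : Fin l → SimpleRoot b) (a : weights P) :
    ((Fin l → Bool) → Sym F P) →ₗ[Sym F P] ((Fin l → Bool) → Sym F P) :=
  LinearMap.mulLeft (Sym F P) fun σ => inc F P (bar F P (act P (ev s σ) a))

/-- The module `𝒳(s)`: for the empty sequence it is everything, and
`𝒳(s) = Δ(𝒳(s')) + c^α Δ(𝒳(s'))` if `α` is the last simple affine root of `s` and `s'` is the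
truncation of `s`. -/
def X : (l : ℕ) → (s : Fin l → SimpleRoot b) → Submodule (Sym F P) ((Fin l → Bool) → Sym F P)
  | 0, _ => ⊤
  | l + 1, s =>
    (X l (Fin.init s)).map (diag F P l) ⊔
      (X l (Fin.init s)).map
        (weightMul F s (rootWeight P (s (Fin.last l)).1) ∘ₗ diag F P l)

end Sequences

end AffineWeyl

end

open scoped TensorProduct

noncomputable section

/-! ### Linear forms in the symmetric algebra -/

namespace SymmetricAlgebra

variable {K M : Type*} [Field K] [AddCommGroup M] [Module K M]

/-! Write 𝒳(s)_x for the restriction of 𝒳(s) to the subsequences with product x. Divisibility along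
edges is proved by induction on the length of s, together with a second statement that makes the
induction close: if β, γ are linearly independent and βt = γu in 𝒳(s)_x, then t is γ times an
element of 𝒳(s)_x (`RegularOnStalks`).

Let α be the last simple root of s and r its reflection. On the subsequences with product x the
operator c^α is a scalar, so 𝒳(s)_x is the restriction of 𝒳(s') to the subsequences with product x
or xr (`exists_restrict_eq`). The vertices x, xr are joined by an edge E₀, with label λ. By
divisibility for s' along E₀, an element of this restriction that vanishes over the source of E₀ is
λ times an element of 𝒳(s') over the target; conversely every such multiple extends by zero
(`exists_extension_by_zero`, using 1/2). So 𝒳(s)_x is an extension of 𝒳(s') at the source by λ times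
𝒳(s') at the target, and regularity passes from s' to s.

For divisibility along y → x with label γ, the case x = yr is a direct computation. Otherwise yr →
xr is an edge with the same label, and the inductive hypothesis makes f divisible by γ separately
over x and over xr. The two quotients need not come from one element of 𝒳(s'). Correcting the first
one reduces to an equation λt = γw at the target of E₀; the GKM-property makes λ and γ independent,
and regularity divides t by γ.

The combinatorial input is that y → s_γ y is an edge exactly when y⁻¹γ is positive, and that
products of subsequences are closed under descending along edges. Both follow from the exchange
condition, hence from the fact that a simple affine reflection makes no positive root negative
except its own. -/

theorem exists_eq_mul_of_linearIndependent {β γ : M} (h : LinearIndependent K ![β, γ])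
    {t u : SymmetricAlgebra K M} (htu : ι K M β * t = ι K M γ * u) :
    ∃ v, t = ι K M γ * v := by
  -- In a basis extending β, γ the symmetric algebra becomes a polynomial ring in which β and γ are
  -- distinct variables, and a variable is prime.
  have hr := h.linearIndepOn_id
  set B := Module.Basis.extend hr
  have hβ : β ∈ hr.extend (Set.subset_univ _) := hr.subset_extend _ ⟨0, rfl⟩
  have hγ : γ ∈ hr.extend (Set.subset_univ _) := hr.subset_extend _ ⟨1, rfl⟩
  have hne : (⟨γ, hγ⟩ : hr.extend (Set.subset_univ _)) ≠ ⟨β, hβ⟩ := by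
    intro h'
    have h1 : β = γ := (congrArg Subtype.val h').symm
    have h2 := h.injective.ne (show (0 : Fin 2) ≠ 1 by decide)
    exact h2 (by simpa using h1)
  have eβ : equivMvPolynomial B (ι K M β) = .X ⟨β, hβ⟩ := by
    rw [← equivMvPolynomial_ι_apply B ⟨β, hβ⟩, Module.Basis.extend_apply_self]
  have eγ : equivMvPolynomial B (ι K M γ) = .X ⟨γ, hγ⟩ := by
    rw [← equivMvPolynomial_ι_apply B ⟨γ, hγ⟩, Module.Basis.extend_apply_self]
  have h1 := congrArg (equivMvPolynomial B) htu
  rw [map_mul, map_mul, eβ, eγ] at h1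
  have h2 : (MvPolynomial.X ⟨γ, hγ⟩ : MvPolynomial _ K) ∣ MvPolynomial.X ⟨β, hβ⟩ *
      equivMvPolynomial B t := ⟨_, h1⟩
  rcases (MvPolynomial.X_prime).dvd_or_dvd h2 with h3 | ⟨v, hv⟩
  · exact absurd (MvPolynomial.X_dvd_X.mp h3) hne
  · refine ⟨(equivMvPolynomial B).symm v, (equivMvPolynomial B).injective ?_⟩
    rw [map_mul, eγ, hv, AlgEquiv.apply_symm_apply]

theorem ι_ne_zero {γ : M} (h : γ ≠ 0) : ι K M γ ≠ 0 := by
  have hr : LinearIndepOn K id {γ} := LinearIndepOn.singleton h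
  set B := Module.Basis.extend hr
  have hγ : γ ∈ hr.extend (Set.subset_univ _) := hr.subset_extend _ rfl
  have eγ : equivMvPolynomial B (ι K M γ) = .X ⟨γ, hγ⟩ := by
    rw [← equivMvPolynomial_ι_apply B ⟨γ, hγ⟩, Module.Basis.extend_apply_self]
  intro h0
  rw [h0, map_zero] at eγ
  exact MvPolynomial.X_ne_zero _ eγ.symm

end SymmetricAlgebra

/-! ### Heights and dominant roots -/

namespace RootPairing.Base

variable {ι V V' : Type*} [AddCommGroup V] [Module ℚ V] [AddCommGroup V'] [Module ℚ V']
  {P : RootPairing ι ℚ V V'} (b : P.Base)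

section Height

variable [P.IsRootSystem]

/-- The linear form on the root space taking the value one on every simple root. -/
def heightForm : V →ₗ[ℚ] ℚ := b.toWeightBasis.constr ℚ fun _ => (1 : ℚ)

theorem heightForm_simple {i : ι} (hi : i ∈ b.support) : b.heightForm (P.root i) = 1 := by
  have h := b.toWeightBasis.constr_basis ℚ (fun _ => (1 : ℚ)) ⟨i, hi⟩
  simpa [heightForm] using h

theorem heightForm_root (i : ι) : b.heightForm (P.root i) = b.height i := by
  obtain ⟨f, -, -, hf⟩ := b.exists_root_eq_sum_int i
  rw [height_eq_sum hf, hf, map_sum, Int.cast_sum]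
  refine Finset.sum_congr rfl fun j hj => ?_
  rw [map_zsmul, b.heightForm_simple hj]
  simp

theorem eq_zero_or_heightForm_pos {v : V} (hv : v ∈ AddSubmonoid.closure (P.root '' b.support)) :
    v = 0 ∨ 0 < b.heightForm v := by
  induction hv using AddSubmonoid.closure_induction with
  | mem v hv =>
    obtain ⟨i, hi, rfl⟩ := hv
    simp [b.heightForm_simple hi]
  | zero => exact Or.inl rfl
  | add v w _ _ ihv ihw =>
    rcases ihv with rfl | ihv
    · simpa using ihw
    · rcases ihw with rfl | ihw
      · simpa using Or.inr ihv
      · exact Or.inr (by rw [map_add]; positivity)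

theorem heightForm_nonneg {v : V} (hv : v ∈ AddSubmonoid.closure (P.root '' b.support)) :
    0 ≤ b.heightForm v := by
  rcases b.eq_zero_or_heightForm_pos hv with rfl | h
  · simp
  · exact h.le

theorem isPos_iff_heightForm {i : ι} : b.IsPos i ↔ 0 < b.heightForm (P.root i) := by
  rw [heightForm_root, isPos_iff, Int.cast_pos]

end Height

section Form

variable [Fintype ι] [P.IsCrystallographic]

omit [P.IsCrystallographic] in
theorem two_mul_rootForm_root (i j : ι) :
    2 * P.RootForm (P.root i) (P.root j) =
      P.pairing i j * P.RootForm (P.root j) (P.root j) :=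
  P.toInvariantForm.two_mul_apply_root_root i j

omit [P.IsCrystallographic] in
theorem rootForm_root_self_pos (i : ι) : 0 < P.RootForm (P.root i) (P.root i) :=
  P.rootForm_pos_of_ne_zero (Submodule.subset_span ⟨i, rfl⟩) (P.ne_zero i)

theorem rootForm_root_nonneg_iff {i j : ι} :
    0 ≤ P.RootForm (P.root i) (P.root j) ↔ 0 ≤ P.pairingIn ℤ i j := by
  have h1 := two_mul_rootForm_root (P := P) i j
  have h2 := rootForm_root_self_pos (P := P) j
  rw [← P.algebraMap_pairingIn ℤ, eq_intCast] at h1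
  constructor
  · intro h
    have : (0 : ℚ) ≤ P.pairingIn ℤ i j := by
      by_contra! h3
      nlinarith
    exact_mod_cast this
  · intro h
    have : (0 : ℚ) ≤ P.pairingIn ℤ i j := by exact_mod_cast h
    nlinarith [mul_nonneg this h2.le]

theorem rootForm_root_pos_iff {i j : ι} :
    0 < P.RootForm (P.root i) (P.root j) ↔ 0 < P.pairingIn ℤ i j := by
  have h1 := two_mul_rootForm_root (P := P) i j
  have h2 := rootForm_root_self_pos (P := P) j
  rw [← P.algebraMap_pairingIn ℤ, eq_intCast] at h1
  constructor
  · intro h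
    have : (0 : ℚ) < P.pairingIn ℤ i j := by
      by_contra! h3
      nlinarith
    exact_mod_cast this
  · intro h
    have : (0 : ℚ) < P.pairingIn ℤ i j := by exact_mod_cast h
    nlinarith [mul_pos this h2]

omit [P.IsCrystallographic] in
theorem rootForm_nonneg_of_mem_closure {v w : V}
    (hv : ∀ j ∈ b.support, 0 ≤ P.RootForm v (P.root j))
    (hw : w ∈ AddSubmonoid.closure (P.root '' b.support)) : 0 ≤ P.RootForm v w := by
  induction hw using AddSubmonoid.closure_induction with
  | mem w hw => obtain ⟨i, hi, rfl⟩ := hw; exact hv i hi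
  | zero => simp
  | add w w' _ _ ih ih' => rw [map_add]; positivity

/-- A dominant root is positive. -/
theorem mem_closure_of_dominant {i : ι} (h : ∀ j ∈ b.support, 0 ≤ P.pairingIn ℤ i j) :
    P.root i ∈ AddSubmonoid.closure (P.root '' b.support) := by
  refine (b.root_mem_or_neg_mem i).resolve_right fun h' => ?_
  have := b.rootForm_nonneg_of_mem_closure (fun j hj => rootForm_root_nonneg_iff.mpr (h j hj)) h'
  rw [map_neg] at this
  linarith [rootForm_root_self_pos (P := P) i]

omit [P.IsCrystallographic] in
theorem exists_pairing_ne_zero [P.IsRootSystem] (i : ι) :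
    ∃ j ∈ b.support, P.RootForm (P.root i) (P.root j) ≠ 0 := by
  by_contra! h
  have h1 : (⊤ : Submodule ℚ V) ≤ LinearMap.ker (P.RootForm (P.root i)) := by
    rw [← RootPairing.IsRootSystem.span_root_eq_top (P := P)]
    change P.rootSpan ℚ ≤ _
    rw [← b.span_root_support, Submodule.span_le]
    rintro _ ⟨j, hj, rfl⟩
    exact h j hj
  exact (rootForm_root_self_pos (P := P) i).ne' (h1 (Submodule.mem_top (x := P.root i)))

/-- In an irreducible root system, the root form of two dominant roots is positive. -/
theorem rootForm_pos_of_dominant [P.IsRootSystem] [P.IsReduced] [P.IsIrreducible] {i k : ι}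
    (hi : ∀ j ∈ b.support, 0 ≤ P.pairingIn ℤ i j) (hk : ∀ j ∈ b.support, 0 ≤ P.pairingIn ℤ k j) :
    0 < P.RootForm (P.root i) (P.root k) := by
  classical
  have hi' : ∀ j ∈ b.support, 0 ≤ P.RootForm (P.root i) (P.root j) :=
    fun j hj => rootForm_root_nonneg_iff.mpr (hi j hj)
  obtain ⟨f, hf⟩ : ∃ f : ι → ℕ, P.root k = ∑ j ∈ b.support, f j • P.root j := by
    obtain ⟨f, -, hf | hf⟩ := b.exists_root_eq_sum_nat_or_neg k
    · exact ⟨f, hf⟩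
    · exfalso
      have h1 := b.heightForm_nonneg (b.mem_closure_of_dominant hk)
      have h2 := (b.eq_zero_or_heightForm_pos (b.mem_closure_of_dominant hk)).resolve_left
        (P.ne_zero k)
      rw [hf, map_neg, map_sum] at h2
      have : 0 ≤ ∑ j ∈ b.support, b.heightForm (f j • P.root j) :=
        Finset.sum_nonneg fun j hj => by rw [map_nsmul, b.heightForm_simple hj]; positivity
      linarith
  -- The simple roots occurring in the `k`-th root span a subspace stable under all simple
  -- reflections; irreducibility then forces every simple root to occur.
  set s : Set ι := {j | j ∈ b.support ∧ f j ≠ 0} with hs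
  set q : Submodule ℚ V := Submodule.span ℚ (P.root '' s)
  have hkq : P.root k ∈ q := by
    rw [hf]
    refine Submodule.sum_mem _ fun j hj => ?_
    by_cases h0 : f j = 0
    · simp [h0]
    · exact Submodule.smul_of_tower_mem _ _ (Submodule.subset_span ⟨j, ⟨hj, h0⟩, rfl⟩)
  have hinv : ∀ j ∈ b.support, q ∈ Module.End.invtSubmodule (P.reflection j) := by
    intro j hj
    by_cases hjs : f j = 0
    · have hle : q ≤ LinearMap.ker (P.coroot' j) := by
        refine Submodule.span_le.mpr ?_
        rintro _ ⟨m, ⟨hm, hm0⟩, rfl⟩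
        have hsum : (P.pairingIn ℤ k j) = ∑ n ∈ b.support, f n * P.pairingIn ℤ n j := by
          have : P.coroot' j (P.root k) = ∑ n ∈ b.support, f n * P.pairing n j := by
            rw [hf, map_sum]
            simp
          rw [P.root_coroot'_eq_pairing] at this
          simp only [← P.algebraMap_pairingIn ℤ, eq_intCast] at this
          exact_mod_cast this
        have hterm : ∀ n ∈ b.support, (f n : ℤ) * P.pairingIn ℤ n j ≤ 0 := by
          intro n hn
          by_cases hnj : n = j
          · simp [hnj, hjs]
          · exact mul_nonpos_of_nonneg_of_nonpos (by positivity)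
              (b.pairingIn_le_zero_of_ne hnj hn hj)
        have h0 : ∑ n ∈ b.support, (f n : ℤ) * P.pairingIn ℤ n j = 0 :=
          le_antisymm (Finset.sum_nonpos hterm) (hsum ▸ hk j hj)
        have h1 := (Finset.sum_eq_zero_iff_of_nonpos hterm).mp h0 m hm
        have h2 : P.pairingIn ℤ m j = 0 := by
          rcases mul_eq_zero.mp h1 with h | h
          · exact absurd (by exact_mod_cast h) hm0
          · exact h
        simp [← P.algebraMap_pairingIn ℤ, h2]
      refine (Module.End.mem_invtSubmodule _).mpr fun x hx => ?_
      have h3 : P.coroot' j x = 0 := hle hx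
      simpa [RootPairing.reflection_apply, h3] using hx
    · exact Submodule.mem_invtSubmodule_reflection_of_mem _ _
        (Submodule.subset_span ⟨j, ⟨hj, hjs⟩, rfl⟩)
  have htop : q = ⊤ := IsIrreducible.eq_top_of_invtSubmodule_reflection q
    (b.forall_mem_support_invtSubmodule_iff q |>.mp hinv)
    (fun h => P.ne_zero k (by simpa [h] using hkq))
  obtain ⟨m, hm, hm0⟩ := b.exists_pairing_ne_zero i
  have hfm : f m ≠ 0 := by
    intro h0
    have h1 : P.root m ∉ Submodule.span ℚ (P.root '' ((b.support : Set ι) \ {m})) :=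
      (linearIndepOn_iff_notMem_span.mp b.linearIndepOn_root) m hm
    refine h1 (Submodule.span_mono (Set.image_mono ?_) (htop ▸ Submodule.mem_top : P.root m ∈ q))
    rintro n ⟨hn, hn0⟩
    exact ⟨hn, fun h => hn0 (by rw [Set.mem_singleton_iff.mp h, h0])⟩
  rw [hf, map_sum]
  refine Finset.sum_pos' (fun j hj => ?_) ⟨m, hm, ?_⟩
  · rw [map_nsmul]
    exact nsmul_nonneg (hi' j hj) _
  · rw [map_nsmul]
    exact nsmul_pos ((hi' m hm).lt_of_ne' hm0) hfm

end Form

end RootPairing.Base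

/-! ### Existence of the highest root -/

namespace AffineWeyl

variable {ι V V' : Type*} [AddCommGroup V] [Module ℚ V] [AddCommGroup V'] [Module ℚ V']
  {P : RootPairing ι ℚ V V'} (b : P.Base)

open RootPairing.Base in
/-- An irreducible root system has a highest root. -/
theorem exists_isHighest [Finite ι] [P.IsRootSystem] [P.IsCrystallographic] [P.IsReduced]
    [P.IsIrreducible] : ∃ i, IsHighest b i := by
  have := Fintype.ofFinite ι
  have hne : Nonempty ι := by
    have := RootPairing.IsIrreducible.nontrivial P
    by_contra h
    rw [not_nonempty_iff] at h
    have h1 := RootPairing.IsRootSystem.span_root_eq_top (P := P)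
    rw [Set.range_eq_empty, Submodule.span_empty] at h1
    exact bot_ne_top h1
  obtain ⟨θ, hθ⟩ := Finite.exists_max b.height
  have hθpos : 0 < b.height θ := by
    obtain ⟨j, hj⟩ := b.support_nonempty
    have := hθ j
    rw [height_one_of_mem_support hj] at this
    lia
  -- A negative pairing with a simple root would make their sum a root of larger height.
  have hdom : ∀ j ∈ b.support, 0 ≤ P.pairingIn ℤ θ j := by
    intro j hj
    by_contra! h
    have hne : P.root θ ≠ -P.root j := by
      intro h'
      have := congrArg b.heightForm h'
      rw [map_neg, b.heightForm_root, b.heightForm_simple hj] at this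
      have : b.height θ = -1 := by exact_mod_cast this
      lia
    obtain ⟨k, hk⟩ := P.root_add_root_mem_of_pairingIn_neg h hne
    have h1 := b.height_add hk
    rw [height_one_of_mem_support hj] at h1
    have := hθ k
    lia
  refine ⟨θ, ?_⟩
  by_contra hnot
  have hnot' : Nonempty {j // P.root θ - P.root j ∉ AddSubmonoid.closure (P.root '' b.support)} := by
    unfold IsHighest at hnot
    push Not at hnot
    obtain ⟨j, hj⟩ := hnot
    exact ⟨⟨j, hj⟩⟩
  -- A counterexample of maximal height is again dominant: a simple root pairing negatively with it
  -- could be added, giving a higher counterexample.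
  obtain ⟨⟨β, hβ⟩, hmax⟩ := Finite.exists_max
    fun j : {j // P.root θ - P.root j ∉ AddSubmonoid.closure (P.root '' b.support)} => b.height j.1
  have hθC := b.mem_closure_of_dominant hdom
  have hβdom : ∀ j ∈ b.support, 0 ≤ P.pairingIn ℤ β j := by
    intro j hj
    have hjC : P.root j ∈ AddSubmonoid.closure (P.root '' b.support) :=
      AddSubmonoid.subset_closure ⟨j, hj, rfl⟩
    by_contra! h
    have hne : P.root β ≠ -P.root j := by
      intro h'
      exact hβ (by rw [h', sub_neg_eq_add]; exact add_mem hθC hjC)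
    obtain ⟨k, hk⟩ := P.root_add_root_mem_of_pairingIn_neg h hne
    have h1 := b.height_add hk
    rw [height_one_of_mem_support hj] at h1
    by_cases hkC : P.root θ - P.root k ∈ AddSubmonoid.closure (P.root '' b.support)
    · refine hβ ?_
      have : P.root θ - P.root β = (P.root θ - P.root k) + P.root j := by rw [hk]; abel
      rw [this]
      exact add_mem hkC hjC
    · have := hmax ⟨k, hkC⟩
      simp only at this
      lia
  -- Two dominant roots pair positively, so θ − β is a root; maximality of the height of θ excludes
  -- that it is negative.
  have hpos := rootForm_root_pos_iff.mp (b.rootForm_pos_of_dominant hdom hβdom)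
  have hθβ : θ ≠ β := by
    rintro rfl
    exact hβ (by simp)
  obtain ⟨k, hk⟩ := P.root_sub_root_mem_of_pairingIn_pos hpos hθβ
  rcases b.root_mem_or_neg_mem k with h | h
  · exact hβ (hk ▸ h)
  · have h1 := b.height_sub hk
    have h2 := b.heightForm_nonneg h
    rw [map_neg, b.heightForm_root] at h2
    have h3 : b.height k ≤ 0 := by
      have : (b.height k : ℚ) ≤ 0 := by linarith
      exact_mod_cast this
    have := hθ β
    have := b.height_ne_zero k
    lia

end AffineWeyl

/-! ### Action on affine roots and conjugation of reflections -/

namespace AffineWeyl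

variable {ι V V' : Type*} [AddCommGroup V] [Module ℚ V] [AddCommGroup V'] [Module ℚ V']

section Conjugation

variable (P : RootPairing ι ℚ V V')

theorem dualAct_affineReflection (γ : ι × ℤ) (a : V × ℚ) :
    dualAct P (affineReflection P γ).1 a = a - P.coroot' γ.1 a.1 • rootVec P γ := by
  have h : dualAct P (affineReflection P γ).1 a = dualAct P (reflection P γ.1 (-γ.2)) a := rfl
  rw [h, dualAct_reflection]
  refine Prod.ext ?_ ?_
  · simp [rootVec, RootPairing.reflection_apply]
  · simp [rootVec]
    ring

theorem rootVec_injective : Function.Injective (rootVec P) := by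
  rintro ⟨i, m⟩ ⟨j, n⟩ h
  simpa [rootVec] using h

theorem affineReflection_mul_self (γ : ι × ℤ) :
    affineReflection P γ * affineReflection P γ = 1 :=
  Subtype.ext (reflection_mul_self P _ _)

theorem affineReflection_inv (γ : ι × ℤ) : (affineReflection P γ)⁻¹ = affineReflection P γ :=
  inv_eq_of_mul_eq_one_left (affineReflection_mul_self P γ)

variable [P.IsCrystallographic]

/-- The affine root obtained from the affine root `δ` by the reflection `s_γ`. -/
def reflectRoot (γ δ : ι × ℤ) : ι × ℤ :=
  (P.reflectionPerm γ.1 δ.1, δ.2 - γ.2 * P.pairingIn ℤ δ.1 γ.1)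

theorem rootVec_reflectRoot (γ δ : ι × ℤ) :
    dualAct P (affineReflection P γ).1 (rootVec P δ) = rootVec P (reflectRoot P γ δ) := by
  rw [dualAct_affineReflection]
  have h : (P.pairingIn ℤ δ.1 γ.1 : ℚ) = P.pairing δ.1 γ.1 := by
    rw [← P.algebraMap_pairingIn ℤ, eq_intCast]
  refine Prod.ext ?_ ?_
  · simp [rootVec, reflectRoot, RootPairing.reflection_apply]
  · simp [rootVec, reflectRoot, h]
    ring

theorem affineReflection_reflectRoot (γ δ : ι × ℤ) :
    affineReflection P γ * affineReflection P δ * (affineReflection P γ)⁻¹ =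
      affineReflection P (reflectRoot P γ δ) := by
  rw [affineReflection_inv]
  apply Subtype.ext
  have h : (P.pairingIn ℤ δ.1 γ.1 : ℚ) = P.pairing δ.1 γ.1 := by
    rw [← P.algebraMap_pairingIn ℤ, eq_intCast]
  ext v
  change reflection P γ.1 (-γ.2) (reflection P δ.1 (-δ.2) (reflection P γ.1 (-γ.2) v)) =
    reflection P (reflectRoot P γ δ).1 (-(reflectRoot P γ δ).2) v
  have h2 : P.toLinearMap (P.root γ.1) (P.coroot γ.1) = 2 := P.root_coroot_two _
  simp only [reflection_apply, reflectRoot, RootPairing.root_reflectionPerm,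
    RootPairing.coroot_reflectionPerm, RootPairing.reflection_apply,
    RootPairing.coreflection_apply, map_sub, map_smul, LinearMap.sub_apply, LinearMap.smul_apply,
    RootPairing.root_coroot_eq_pairing, RootPairing.root_coroot'_eq_pairing,
    smul_eq_mul, RootPairing.pairing_same, h, Int.cast_neg,
    Int.cast_sub, Int.cast_mul]
  module

/-- The affine Weyl group permutes the affine roots, compatibly with the conjugation action on
reflections. -/
theorem exists_root_conj (w : weylGroup P) (δ : ι × ℤ) :
    ∃ ε, dualAct P w.1 (rootVec P δ) = rootVec P ε ∧
      w * affineReflection P δ * w⁻¹ = affineReflection P ε := by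
  obtain ⟨w, hw⟩ := w
  induction hw using Subgroup.closure_induction_left generalizing δ with
  | one => exact ⟨δ, dualAct_one P _, Subtype.ext (by simp)⟩
  | mul_left x hx y hy ih =>
    obtain ⟨p, rfl⟩ := hx
    obtain ⟨ε, h1, h2⟩ := ih δ
    have hp : reflection P p.1 p.2 = (affineReflection P (p.1, -p.2)).1 := by
      simp [affineReflection]
    refine ⟨reflectRoot P (p.1, -p.2) ε, ?_, ?_⟩
    · simp only at h1 ⊢
      rw [dualAct_mul, h1, hp, rootVec_reflectRoot]
    · rw [← affineReflection_reflectRoot, ← h2]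
      apply Subtype.ext
      simp [hp, mul_assoc]
  | inv_mul_cancel x hx y hy ih =>
    obtain ⟨p, rfl⟩ := hx
    obtain ⟨ε, h1, h2⟩ := ih δ
    have hp : (reflection P p.1 p.2)⁻¹ = (affineReflection P (p.1, -p.2)).1 := by
      simp [affineReflection, reflection_inv]
    refine ⟨reflectRoot P (p.1, -p.2) ε, ?_, ?_⟩
    · simp only at h1 ⊢
      rw [dualAct_mul, h1, hp, rootVec_reflectRoot]
    · rw [← affineReflection_reflectRoot, ← h2]
      apply Subtype.ext
      simp [hp, mul_assoc]

variable {P}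

theorem mul_affineReflection_mul_inv {w : weylGroup P} {δ ε : ι × ℤ}
    (h : dualAct P w.1 (rootVec P δ) = rootVec P ε) :
    w * affineReflection P δ * w⁻¹ = affineReflection P ε := by
  obtain ⟨ε', h1, h2⟩ := exists_root_conj P w δ
  rwa [rootVec_injective P (h.symm.trans h1)]

omit [P.IsCrystallographic] in
theorem dualAct_affineReflection_self (γ : ι × ℤ) :
    dualAct P (affineReflection P γ).1 (rootVec P γ) = -rootVec P γ := by
  rw [dualAct_affineReflection]
  have h : P.coroot' γ.1 (rootVec P γ).1 = 2 := P.root_coroot_two _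
  rw [h]
  module

theorem affineReflection_of_rootVec_neg {γ δ : ι × ℤ} (h : rootVec P δ = -rootVec P γ) :
    affineReflection P δ = affineReflection P γ := by
  rw [← mul_affineReflection_mul_inv ((dualAct_affineReflection_self γ).trans h.symm)]
  simp

end Conjugation

/-! ### Positive affine roots under simple reflections -/

section Positive

variable {P : RootPairing ι ℚ V V'} (b : P.Base)

theorem simpleReflection_mul_self (α : SimpleRoot b) :
    simpleReflection b α * simpleReflection b α = 1 := affineReflection_mul_self P α.1

theorem simpleReflection_inv (α : SimpleRoot b) :
    (simpleReflection b α)⁻¹ = simpleReflection b α := affineReflection_inv P α.1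

theorem isPosRoot_simple {γ : ι × ℤ} (h : IsSimpleRoot b γ) : IsPosRoot b γ := by
  rcases h with ⟨h1, h2⟩ | ⟨h1, -⟩
  · exact Or.inr ⟨h1, b.isPos_of_mem_support h2⟩
  · exact Or.inl (by lia)

section Vec

variable [P.IsRootSystem]

/-- The positivity condition on vectors of `V ⊕ ℚ` which on affine roots defines the positive
ones. -/
def IsPosVec (a : V × ℚ) : Prop := 0 < a.2 ∨ (a.2 = 0 ∧ 0 < b.heightForm a.1)

theorem isPosRoot_iff {γ : ι × ℤ} : IsPosRoot b γ ↔ IsPosVec b (rootVec P γ) := by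
  simp [IsPosRoot, IsPosVec, rootVec, b.isPos_iff_heightForm]

variable {b}

theorem IsPosVec.not_neg {a : V × ℚ} (h : IsPosVec b a) : ¬ IsPosVec b (-a) := by
  rintro (h' | ⟨h1', h2'⟩) <;> rcases h with h | ⟨h1, h2⟩ <;>
    simp only [Prod.snd_neg, Prod.fst_neg, map_neg] at * <;> linarith

variable (b)

theorem isPosVec_or_neg (γ : ι × ℤ) : IsPosVec b (rootVec P γ) ∨ IsPosVec b (-rootVec P γ) := by
  have h0 : b.heightForm (P.root γ.1) ≠ 0 := by
    rw [b.heightForm_root]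
    exact_mod_cast b.height_ne_zero γ.1
  simp only [IsPosVec, rootVec, Prod.snd_neg, Prod.fst_neg, map_neg, Left.neg_pos_iff,
    neg_eq_zero]
  rcases lt_trichotomy (γ.2 : ℚ) 0 with h | h | h
  · exact Or.inr (Or.inl h)
  · rcases lt_or_gt_of_ne h0 with h' | h'
    · exact Or.inr (Or.inr ⟨h, h'⟩)
    · exact Or.inl (Or.inr ⟨h, h'⟩)
  · exact Or.inl (Or.inl h)

theorem IsHighest.mem_closure {θ : ι} (h : IsHighest b θ) :
    P.root θ ∈ AddSubmonoid.closure (P.root '' b.support) := by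
  refine (b.root_mem_or_neg_mem θ).resolve_right fun h' => ?_
  have h1 := b.heightForm_nonneg (h (P.reflectionPerm θ θ))
  rw [P.root_reflectionPerm, P.reflection_apply_self, sub_neg_eq_add, map_add] at h1
  have h2 := (b.eq_zero_or_heightForm_pos h').resolve_left (neg_ne_zero.mpr (P.ne_zero θ))
  rw [map_neg] at h2
  linarith

end Vec

variable [Finite ι] [P.IsRootSystem] [P.IsCrystallographic] [P.IsReduced]

omit [Finite ι] [P.IsReduced] in
-- The reflection sends (β, n) to (β + pθ, n − p) with p = ⟨β, (−θ)^∨⟩. Comparing the heights of β +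
-- pθ and of −β with that of θ gives p ≤ 2, and p = 2 only for β = −θ. The borderline cases are n =
-- p, where the sign is decided by the height of the finite part.
theorem isPosVec_reflect_neg_highest {θ : ι} (hθ : IsHighest b θ) {α γ : ι × ℤ}
    (h2 : α.2 = 1) (h1 : P.root α.1 = -P.root θ) (hγ : IsPosRoot b γ) (hne : γ ≠ α) :
    IsPosVec b (dualAct P (affineReflection P α).1 (rootVec P γ)) := by
  obtain ⟨j, n⟩ := γ
  have hθC := hθ.mem_closure b
  have hθpos := (b.eq_zero_or_heightForm_pos hθC).resolve_left (P.ne_zero θ)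
  have hrefl : (rootVec P (reflectRoot P α (j, n))) =
      (P.root j + P.pairingIn ℤ j α.1 • P.root θ, (n : ℚ) - P.pairingIn ℤ j α.1) := by
    rw [← rootVec_reflectRoot, dualAct_affineReflection]
    have h : P.coroot' α.1 (rootVec P (j, n)).1 = P.pairingIn ℤ j α.1 := by
      rw [← eq_intCast (algebraMap ℤ ℚ), P.algebraMap_pairingIn]
      exact P.root_coroot'_eq_pairing _ _
    rw [h]
    refine Prod.ext ?_ ?_
    · simp [rootVec, h1, Int.cast_smul_eq_zsmul]
    · simp [rootVec, h2]
  rw [rootVec_reflectRoot, hrefl]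
  set p := P.pairingIn ℤ j α.1
  have hroot : P.root (P.reflectionPerm α.1 j) = P.root j + p • P.root θ := congrArg Prod.fst hrefl
  have hC := hθ (P.reflectionPerm α.1 j)
  rw [hroot] at hC
  have hC' := hθ (P.reflectionPerm j j)
  rw [P.root_reflectionPerm, P.reflection_apply_self, sub_neg_eq_add] at hC'
  have hsum := b.heightForm_nonneg hC
  have hsum' := b.heightForm_nonneg hC'
  simp only [map_add, map_sub, map_zsmul, zsmul_eq_mul] at hsum hsum'
  unfold IsPosVec
  simp only [map_add, map_zsmul, zsmul_eq_mul]
  have hθj : P.root j = -P.root θ → n ≠ 1 := by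
    intro h hn
    apply hne
    apply rootVec_injective P
    refine Prod.ext ?_ ?_
    · simp [rootVec, h, h1]
    · simp [rootVec, hn, h2]
  -- a pairing of absolute value at least two occurs only for `-θ`
  have hp : p ≤ 1 ∨ (p = 2 ∧ P.root j = -P.root θ) := by
    by_cases hp1 : p ≤ 1
    · exact Or.inl hp1
    right
    push Not at hp1
    have hp2 : p = 2 := by
      by_contra h
      have : (3 : ℚ) ≤ p := by exact_mod_cast (show (3 : ℤ) ≤ p by lia)
      nlinarith
    rw [hp2] at hsum
    push_cast at hsum
    refine ⟨hp2, ?_⟩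
    rcases b.eq_zero_or_heightForm_pos hC' with h | h
    · exact (neg_eq_of_add_eq_zero_right h).symm
    · rw [map_add] at h
      linarith
  have hn : 0 < n ∨ (n = 0 ∧ b.IsPos j) := hγ
  rcases hp with hp | ⟨hp, hj⟩
  · rcases hn with hn | ⟨hn, hpos⟩
    · by_cases hnp : n = p
      · have hp1 : p = 1 := by lia
        refine Or.inr ⟨by rw [hnp]; simp, ?_⟩
        rw [hp1]
        have := (b.eq_zero_or_heightForm_pos hC').resolve_left fun h =>
          hθj (neg_eq_of_add_eq_zero_right h).symm (by lia)
        rw [map_add] at this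
        simpa [add_comm] using this
      · left
        have : p < n := by lia
        rw [sub_pos]
        exact_mod_cast this
    · have hj := b.isPos_iff_heightForm.mp hpos
      have hp0 : p ≤ 0 := by
        by_contra h
        have : (1 : ℚ) ≤ p := by exact_mod_cast (show (1 : ℤ) ≤ p by lia)
        nlinarith
      rcases hp0.lt_or_eq with hp0 | hp0
      · left
        rw [hn, Int.cast_zero, zero_sub, Left.neg_pos_iff]
        exact_mod_cast hp0
      · right
        rw [hn, hp0]
        simpa using hj
  · have hnj : ¬ b.IsPos j := by
      rw [b.isPos_iff_heightForm, hj, map_neg]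
      linarith
    have hn1 := hθj hj
    have hn2 : 2 ≤ n := by
      rcases hn with hn | ⟨-, hn⟩
      · lia
      · exact absurd hn hnj
    rcases hn2.lt_or_eq with hn2 | hn2
    · left
      rw [hp, sub_pos]
      exact_mod_cast hn2
    · right
      rw [← hn2, hp, hj, map_neg]
      refine ⟨by norm_num, ?_⟩
      push_cast
      linarith

/-- A simple reflection permutes the positive affine roots other than the simple root. -/
theorem isPosVec_simpleReflection (α : SimpleRoot b) {γ : ι × ℤ} (hγ : IsPosRoot b γ)
    (hne : γ ≠ α.1) : IsPosVec b (dualAct P (simpleReflection b α).1 (rootVec P γ)) := by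
  obtain ⟨α, ⟨hα, hs⟩ | ⟨hα, θ, hθ, hθα⟩⟩ := α
  · change IsPosVec b (dualAct P (affineReflection P α).1 (rootVec P γ))
    rw [rootVec_reflectRoot, ← isPosRoot_iff]
    rcases hγ with h | ⟨h, hpos⟩
    · exact Or.inl (by simpa [reflectRoot, hα] using h)
    · refine Or.inr ⟨by simp [reflectRoot, hα, h], hpos.reflectionPerm hs fun h' => hne ?_⟩
      exact Prod.ext h' (h.trans hα.symm)
  · exact isPosVec_reflect_neg_highest b hθ hα hθα hγ hne

/-- A positive affine root made negative by a simple reflection is the simple root. -/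
theorem eq_simple_of_isPosVec_neg (α : SimpleRoot b) {γ : ι × ℤ} (hγ : IsPosVec b (rootVec P γ))
    (h : IsPosVec b (-dualAct P (simpleReflection b α).1 (rootVec P γ))) : γ = α.1 := by
  by_contra hne
  exact (isPosVec_simpleReflection b α ((isPosRoot_iff b).mpr hγ) hne).not_neg h

end Positive

end AffineWeyl

/-! ### Generation by simple reflections -/

namespace AffineWeyl

variable {ι V V' : Type*} [AddCommGroup V] [Module ℚ V] [AddCommGroup V'] [Module ℚ V']

section Preliminaries

variable {P : RootPairing ι ℚ V V'} {b : P.Base}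

theorem length_lt_of_lt {x y : weylGroup P} (h : (bruhatOrder b).lt x y) :
    length b x < length b y := by
  rcases eq_or_length_lt b ((bruhatOrder b).lt_iff_le_not_ge _ _ |>.mp h).1 with rfl | h'
  · exact absurd h (@lt_irrefl _ (bruhatOrder b).toPreorder x)
  · exact h'

theorem dualAct_inv_mul_affineReflection (x : weylGroup P) (γ : ι × ℤ) :
    dualAct P (affineReflection P γ * x)⁻¹.1 (rootVec P γ) = -dualAct P x⁻¹.1 (rootVec P γ) := by
  rw [mul_inv_rev, affineReflection_inv, Subgroup.coe_mul, dualAct_mul,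
    dualAct_affineReflection_self, map_neg]

end Preliminaries

section Generation

variable {P : RootPairing ι ℚ V V'} (b : P.Base) [Finite ι] [P.IsRootSystem]
  [P.IsCrystallographic] [P.IsReduced]

open RootPairing.Base in
omit [P.IsRootSystem] [P.IsReduced] in
-- If no finite simple root pairs positively with the root β, then −β is dominant. Since θ + β is a
-- nonnegative combination of simple roots, (−β, θ + β) ≥ 0, so (β, −θ) ≥ (β, β) > 0 and the affine
-- simple root serves.
theorem exists_simple_pairing_pos {θ : ι} (hθ : IsHighest b θ) (j : ι) :
    ∃ α : SimpleRoot b, 0 < P.pairingIn ℤ j α.1.1 := by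
  have := Fintype.ofFinite ι
  by_cases h : ∃ i ∈ b.support, 0 < P.pairingIn ℤ j i
  · obtain ⟨i, hi, hpos⟩ := h
    exact ⟨⟨(i, 0), Or.inl ⟨rfl, hi⟩⟩, hpos⟩
  push Not at h
  refine ⟨⟨(P.reflectionPerm θ θ, 1), Or.inr ⟨rfl, θ, hθ, by
    rw [P.root_reflectionPerm, P.reflection_apply_self]⟩⟩, ?_⟩
  have hdom : ∀ i ∈ b.support, 0 ≤ P.RootForm (-P.root j) (P.root i) := by
    intro i hi
    have h1 := h i hi
    rw [← not_lt, ← rootForm_root_pos_iff] at h1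
    rw [map_neg, LinearMap.neg_apply]
    linarith
  have hC := hθ (P.reflectionPerm j j)
  rw [P.root_reflectionPerm, P.reflection_apply_self] at hC
  have h1 := b.rootForm_nonneg_of_mem_closure hdom hC
  have h2 := rootForm_root_self_pos (P := P) j
  rw [← rootForm_root_pos_iff, P.root_reflectionPerm, P.reflection_apply_self, map_neg]
  simp only [map_neg, map_sub, LinearMap.neg_apply] at h1
  linarith

/-- Every positive affine root is conjugate to a simple one under the group generated by the simple
reflections. -/
theorem exists_conj_simple [P.IsIrreducible] (γ : ι × ℤ) (hγ : IsPosRoot b γ) :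
    ∃ w ∈ Subgroup.closure (Set.range (simpleReflection b)), ∃ α : SimpleRoot b,
      dualAct P w.1 (rootVec P α.1) = rootVec P γ := by
  obtain ⟨θ, hθ⟩ := exists_isHighest b
  -- the affine height
  let H : V × ℚ →ₗ[ℚ] ℚ := b.heightForm ∘ₗ LinearMap.fst ℚ V ℚ +
    (b.heightForm (P.root θ) + 1) • LinearMap.snd ℚ V ℚ
  have hH : ∀ a, H a = b.heightForm a.1 + (b.heightForm (P.root θ) + 1) * a.2 := fun a => rfl
  have hθpos := (b.eq_zero_or_heightForm_pos (hθ.mem_closure b)).resolve_left (P.ne_zero θ)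
  -- The coefficient ht θ + 1 is chosen so that (−θ, 1) also has affine height one.
  have hHsimple : ∀ α : SimpleRoot b, H (rootVec P α.1) = 1 := by
    rintro ⟨α, ⟨hα, hs⟩ | ⟨hα, i, hi, hiα⟩⟩
    · rw [hH]
      simp [rootVec, hα, b.heightForm_simple hs]
    · have h1 := b.heightForm_nonneg (hi θ)
      have h2 := b.heightForm_nonneg (hθ i)
      rw [map_sub] at h1 h2
      have h3 : b.heightForm (P.root i) = b.heightForm (P.root θ) := by linarith
      rw [hH]
      simp [rootVec, hα, hiα, h3]
  have hHpos : ∀ γ, IsPosRoot b γ → 0 < H (rootVec P γ) := by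
    rintro ⟨j, n⟩ (hn | ⟨hn, hj⟩)
    · have h1 := b.heightForm_nonneg (hθ (P.reflectionPerm j j))
      rw [P.root_reflectionPerm, P.reflection_apply_self, sub_neg_eq_add, map_add] at h1
      have h2 : (1 : ℚ) ≤ n := by exact_mod_cast (show (1 : ℤ) ≤ n from hn)
      rw [hH]
      simp only [rootVec]
      nlinarith
    · have h1 := b.isPos_iff_heightForm.mp hj
      simp only at hn
      rw [hH]
      simp [rootVec, hn, h1]
  obtain ⟨N, hN⟩ := exists_nat_ge (H (rootVec P γ))
  induction N generalizing γ with
  | zero =>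
    have := hHpos γ hγ
    rw [Nat.cast_zero] at hN
    linarith
  | succ N ih =>
    -- Reflecting in this simple root lowers the affine height by the pairing, which is at least
    -- one, and keeps the root positive unless it is already the simple root.
    obtain ⟨α, hα⟩ := exists_simple_pairing_pos b hθ γ.1
    have hmem : simpleReflection b α ∈ Subgroup.closure (Set.range (simpleReflection b)) :=
      Subgroup.subset_closure ⟨α, rfl⟩
    by_cases hne : γ = α.1
    · exact ⟨1, one_mem _, α, by rw [hne]; exact dualAct_one P _⟩
    · have h1 := isPosVec_simpleReflection b α hγ hne
      have h2 : dualAct P (simpleReflection b α).1 (rootVec P γ) =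
          rootVec P (reflectRoot P α.1 γ) := rootVec_reflectRoot P α.1 γ
      have h3 : H (rootVec P (reflectRoot P α.1 γ)) =
          H (rootVec P γ) - P.pairingIn ℤ γ.1 α.1.1 := by
        have h4 : P.coroot' α.1.1 (rootVec P γ).1 = P.pairingIn ℤ γ.1 α.1.1 := by
          rw [← eq_intCast (algebraMap ℤ ℚ), P.algebraMap_pairingIn]
          exact P.root_coroot'_eq_pairing _ _
        rw [← rootVec_reflectRoot, dualAct_affineReflection, map_sub, map_smul, hHsimple, h4]
        simp
      rw [h2, ← isPosRoot_iff] at h1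
      obtain ⟨w, hw, β, hβ⟩ := ih _ h1 (by
        rw [h3]
        have : (1 : ℚ) ≤ P.pairingIn ℤ γ.1 α.1.1 := by
          exact_mod_cast (show (1 : ℤ) ≤ _ from hα)
        push_cast at hN
        linarith)
      refine ⟨simpleReflection b α * w, mul_mem hmem hw, β, ?_⟩
      rw [Subgroup.coe_mul, dualAct_mul, hβ, ← h2, ← dualAct_mul, ← Subgroup.coe_mul,
        simpleReflection_mul_self, Subgroup.coe_one, dualAct_one]

theorem affineReflection_mem_closure [P.IsIrreducible] (γ : ι × ℤ) (hγ : IsPosRoot b γ) :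
    affineReflection P γ ∈ Subgroup.closure (Set.range (simpleReflection b)) := by
  obtain ⟨w, hw, α, hα⟩ := exists_conj_simple b γ hγ
  rw [← mul_affineReflection_mul_inv hα]
  exact mul_mem (mul_mem hw (Subgroup.subset_closure ⟨α, rfl⟩)) (inv_mem hw)

/-- Edges multiply by s_γ on the left, whereas a Bruhat step multiplies on the right by a conjugate
of a simple reflection; this reconciles the two. -/
theorem inv_mul_affineReflection_mul_mem_reflections [P.IsIrreducible] (y : weylGroup P)
    {γ : ι × ℤ} (hγ : IsPosRoot b γ) : y⁻¹ * (affineReflection P γ * y) ∈ reflections b := by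
  obtain ⟨w, -, α, hα⟩ := exists_conj_simple b γ hγ
  refine ⟨y⁻¹ * w, α, ?_⟩
  rw [← mul_affineReflection_mul_inv hα, simpleReflection]
  group

/-- The affine Weyl group is generated by the simple reflections. -/
theorem closure_simpleReflection [P.IsIrreducible] :
    Subgroup.closure (Set.range (simpleReflection b)) = ⊤ := by
  have hgen : ∀ γ, affineReflection P γ ∈ Subgroup.closure (Set.range (simpleReflection b)) := by
    intro γ
    rcases isPosVec_or_neg b γ with h | h
    · exact affineReflection_mem_closure b γ ((isPosRoot_iff b).mpr h)
    · obtain ⟨δ, hδ⟩ : ∃ δ, rootVec P δ = -rootVec P γ :=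
        ⟨reflectRoot P γ γ, by rw [← rootVec_reflectRoot, dualAct_affineReflection_self]⟩
      rw [← affineReflection_of_rootVec_neg hδ]
      exact affineReflection_mem_closure b δ ((isPosRoot_iff b).mpr (hδ ▸ h))
  rw [eq_top_iff]
  rintro ⟨w, hw⟩ -
  induction hw using Subgroup.closure_induction with
  | mem w hw =>
    obtain ⟨p, rfl⟩ := hw
    convert hgen (p.1, -p.2) using 1
    apply Subtype.ext
    simp [affineReflection]
  | one => exact one_mem _
  | mul x y hx hy ihx ihy => exact mul_mem ihx ihy
  | inv x hx ih => exact inv_mem ih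

theorem exists_word [P.IsIrreducible] (w : weylGroup P) :
    ∃ L : List (SimpleRoot b), (L.map (simpleReflection b)).prod = w := by
  have hw : w ∈ Subgroup.closure (Set.range (simpleReflection b)) :=
    closure_simpleReflection b ▸ Subgroup.mem_top w
  induction hw using Subgroup.closure_induction_left with
  | one => exact ⟨[], rfl⟩
  | mul_left x hx y hy ih =>
    obtain ⟨α, rfl⟩ := hx
    obtain ⟨L, rfl⟩ := ih
    exact ⟨α :: L, by simp⟩
  | inv_mul_cancel x hx y hy ih =>
    obtain ⟨α, rfl⟩ := hx
    obtain ⟨L, rfl⟩ := ih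
    exact ⟨α :: L, by simp [simpleReflection_inv]⟩

end Generation

/-! ### Strong exchange and the edges of the moment graph -/

section Exchange

variable {P : RootPairing ι ℚ V V'} {b : P.Base} [Finite ι] [P.IsRootSystem]
  [P.IsCrystallographic] [P.IsReduced]

/-- If `z s_α` makes a positive root negative, then so does `z`, or the corresponding reflection
cancels the factor `s_α`. -/
theorem isPosVec_neg_or_mul_eq {z : weylGroup P} {α : SimpleRoot b} {γ : ι × ℤ}
    (h : IsPosVec b (-dualAct P (z * simpleReflection b α)⁻¹.1 (rootVec P γ))) :
    IsPosVec b (-dualAct P z⁻¹.1 (rootVec P γ)) ∨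
      affineReflection P γ * (z * simpleReflection b α) = z := by
  obtain ⟨ε, hε, -⟩ := exists_root_conj P z⁻¹ γ
  rcases isPosVec_or_neg b ε with hpos | hneg
  · right
    have h1 : dualAct P (z * simpleReflection b α)⁻¹.1 (rootVec P γ) =
        dualAct P (simpleReflection b α).1 (rootVec P ε) := by
      rw [mul_inv_rev, simpleReflection_inv, Subgroup.coe_mul, dualAct_mul, hε]
    rw [h1] at h
    obtain rfl := eq_simple_of_isPosVec_neg b α hpos h
    have h2 : dualAct P z.1 (rootVec P α.1) = rootVec P γ := by
      rw [← hε, ← dualAct_mul, ← Subgroup.coe_mul, mul_inv_cancel, Subgroup.coe_one, dualAct_one]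
    rw [← mul_affineReflection_mul_inv h2]
    change z * simpleReflection b α * z⁻¹ * (z * simpleReflection b α) = z
    have h3 := simpleReflection_mul_self b α
    calc z * simpleReflection b α * z⁻¹ * (z * simpleReflection b α)
        = z * (simpleReflection b α * simpleReflection b α) := by group
      _ = z := by rw [h3, mul_one]
  · left
    rwa [hε]

/-- The strong exchange condition for words. -/
theorem exists_shorter_word (L : List (SimpleRoot b)) {γ : ι × ℤ} (hγ : IsPosRoot b γ)
    (h : IsPosVec b (-dualAct P ((L.map (simpleReflection b)).prod)⁻¹.1 (rootVec P γ))) :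
    ∃ L' : List (SimpleRoot b), L'.length < L.length ∧
      (L'.map (simpleReflection b)).prod =
        affineReflection P γ * (L.map (simpleReflection b)).prod := by
  induction L using List.reverseRecOn with
  | nil =>
    exfalso
    refine ((isPosRoot_iff b).mp hγ).not_neg ?_
    simpa [dualAct_one] using h
  | append_singleton L α ih =>
    simp only [List.map_append, List.map_cons, List.map_nil, List.prod_append, List.prod_cons,
      List.prod_nil, mul_one] at h ⊢
    rcases isPosVec_neg_or_mul_eq h with h' | h'
    · obtain ⟨L', h1, h2⟩ := ih h'
      refine ⟨L' ++ [α], by simpa using h1, ?_⟩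
      simp [h2, mul_assoc]
    · exact ⟨L, by simp, h'.symm⟩

theorem length_affineReflection_mul_lt [P.IsIrreducible] {x : weylGroup P} {γ : ι × ℤ}
    (hγ : IsPosRoot b γ) (h : IsPosVec b (-dualAct P x⁻¹.1 (rootVec P γ))) :
    length b (affineReflection P γ * x) < length b x := by
  -- Generation by simple reflections makes the set of word lengths nonempty, so the infimum is
  -- attained by an actual word and is not the default value of `sInf ∅`.
  obtain ⟨L, hL, rfl⟩ := Nat.sInf_mem
    (s := {k | ∃ L : List (SimpleRoot b), L.length = k ∧ (L.map (simpleReflection b)).prod = x})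
    (by obtain ⟨L, hL⟩ := exists_word b x; exact ⟨_, L, rfl, hL⟩)
  obtain ⟨L', h1, h2⟩ := exists_shorter_word L hγ h
  calc length b _ ≤ L'.length := Nat.sInf_le ⟨L', rfl, h2⟩
    _ < L.length := h1
    _ = _ := hL

/-- With `exists_edge_of_isPosVec` this replaces the Bruhat order by a sign: were y⁻¹γ negative, s_γ
y would be shorter than y. -/
theorem isPosVec_of_edge [P.IsIrreducible] (E : Edge b) :
    IsPosVec b (dualAct P E.1.1⁻¹.1 (rootVec P E.1.2.2)) := by
  obtain ⟨⟨y, x, γ⟩, hγ, hlt, hx⟩ := E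
  simp only at hγ hlt hx ⊢
  obtain ⟨ε, hε, -⟩ := exists_root_conj P y⁻¹ γ
  rw [hε]
  refine (isPosVec_or_neg b ε).resolve_right fun h => ?_
  have h1 := length_affineReflection_mul_lt hγ (hε ▸ h)
  rw [← hx] at h1
  exact lt_asymm h1 (length_lt_of_lt hlt)

theorem exists_edge_of_isPosVec [P.IsIrreducible] {y : weylGroup P} {γ : ι × ℤ}
    (hγ : IsPosRoot b γ) (h : IsPosVec b (dualAct P y⁻¹.1 (rootVec P γ))) :
    ∃ E : Edge b, E.1 = (y, affineReflection P γ * y, γ) := by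
  have hlen : length b y < length b (affineReflection P γ * y) := by
    have h' := length_affineReflection_mul_lt (x := affineReflection P γ * y) hγ (by
      rwa [dualAct_inv_mul_affineReflection, neg_neg])
    rwa [← mul_assoc, affineReflection_mul_self, one_mul] at h'
  refine ⟨⟨_, hγ, ?_, rfl⟩, rfl⟩
  refine ((bruhatOrder b).lt_iff_le_not_ge _ _).mpr ⟨?_, fun h => ?_⟩
  · exact Relation.ReflTransGen.single
      ⟨hlen, inv_mul_affineReflection_mul_mem_reflections b y hγ⟩
  · rcases eq_or_length_lt b h with h' | h'
    · exact hlen.ne (congrArg (length b) h'.symm)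
    · exact lt_asymm hlen h'

theorem exists_edge_of_dualAct_simple [P.IsIrreducible] {x : weylGroup P} {α : SimpleRoot b}
    {δ : ι × ℤ} (hδ : dualAct P x.1 (rootVec P α.1) = rootVec P δ)
    (hpos : IsPosRoot b δ) :
    ∃ E : Edge b, E.1 = (x, x * simpleReflection b α, δ) := by
  have hconj : affineReflection P δ * x = x * simpleReflection b α := by
    rw [← mul_affineReflection_mul_inv hδ, inv_mul_cancel_right]
    rfl
  rw [← hconj]
  refine exists_edge_of_isPosVec hpos ?_
  rw [← hδ, ← dualAct_mul, ← Subgroup.coe_mul, inv_mul_cancel, Subgroup.coe_one, dualAct_one,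
    ← isPosRoot_iff]
  exact isPosRoot_simple b α.2

/-- For each `x` and each simple reflection `s`, there is an edge connecting `x` and `x s`. -/
theorem exists_edge_mul_simpleReflection [P.IsIrreducible] (x : weylGroup P) (α : SimpleRoot b) :
    ∃ E : Edge b, (E.1.1 = x ∨ E.1.1 = x * simpleReflection b α) ∧
      E.1.2.1 = E.1.1 * simpleReflection b α ∧
      rootWeight P E.1.2.2 = act P E.1.1 (rootWeight P α.1) := by
  obtain ⟨δ, hδ, -⟩ := exists_root_conj P x α.1
  rcases isPosVec_or_neg b δ with h | h
  · obtain ⟨E, hE⟩ := exists_edge_of_dualAct_simple hδ ((isPosRoot_iff b).mpr h)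
    refine ⟨E, Or.inl (by rw [hE]), by rw [hE], Subtype.ext ?_⟩
    rw [hE]
    exact hδ.symm
  -- If xα is negative, the edge starts at x s_α instead, which sends α to the positive root −xα.
  · have hneg' : rootVec P (reflectRoot P δ δ) = -rootVec P δ := by
      rw [← rootVec_reflectRoot, dualAct_affineReflection_self]
    have hneg : dualAct P (x * simpleReflection b α).1 (rootVec P α.1) =
        rootVec P (reflectRoot P δ δ) := by
      rw [Subgroup.coe_mul, dualAct_mul, hneg', ← hδ, ← map_neg]
      congr 1
      exact dualAct_affineReflection_self α.1
    obtain ⟨E, hE⟩ := exists_edge_of_dualAct_simple hneg ((isPosRoot_iff b).mpr (hneg' ▸ h))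
    refine ⟨E, Or.inr (by rw [hE]), by rw [hE], Subtype.ext ?_⟩
    rw [hE]
    exact hneg.symm

/-- The label of an edge from `y` to `y s` is the image under `y` of the simple root. -/
theorem rootWeight_of_edge_mul_simpleReflection [P.IsIrreducible] (E : Edge b) (α : SimpleRoot b)
    (h : E.1.2.1 = E.1.1 * simpleReflection b α) :
    rootWeight P E.1.2.2 = act P E.1.1 (rootWeight P α.1) := by
  have hpos := isPosVec_of_edge E
  obtain ⟨⟨y, x, γ⟩, hγ, hlt, hx⟩ := E
  simp only at hγ hlt hx h hpos ⊢
  obtain ⟨ε, hε, -⟩ := exists_root_conj P y⁻¹ γ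
  rw [hε] at hpos
  have h1 := dualAct_inv_mul_affineReflection y γ
  rw [← hx, h, mul_inv_rev, simpleReflection_inv, Subgroup.coe_mul, dualAct_mul, hε] at h1
  obtain rfl := eq_simple_of_isPosVec_neg b α hpos (by rwa [h1, neg_neg])
  refine Subtype.ext ?_
  change rootVec P γ = dualAct P y.1 (rootVec P α.1)
  rw [← hε, ← dualAct_mul, ← Subgroup.coe_mul, mul_inv_cancel, Subgroup.coe_one, dualAct_one]

/-- An edge remains an edge with the same label after right multiplication by a simple
reflection, unless its vertices are exchanged. -/
theorem exists_edge_mul_right [P.IsIrreducible] (E : Edge b) (α : SimpleRoot b)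
    (hne : E.1.2.1 * simpleReflection b α ≠ E.1.1) :
    ∃ E' : Edge b, E'.1 = (E.1.1 * simpleReflection b α, E.1.2.1 * simpleReflection b α,
      E.1.2.2) := by
  obtain ⟨⟨y, x, γ⟩, hγ, hlt, hx⟩ := E
  have hpos := isPosVec_of_edge ⟨⟨y, x, γ⟩, hγ, hlt, hx⟩
  simp only at hγ hlt hx hne hpos ⊢
  subst hx
  rw [mul_assoc]
  refine exists_edge_of_isPosVec hγ ?_
  obtain ⟨ε, hε, -⟩ := exists_root_conj P (y * simpleReflection b α)⁻¹ γ
  rw [hε]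
  refine (isPosVec_or_neg b ε).resolve_right fun h => ?_
  rw [← hε] at h
  rcases isPosVec_neg_or_mul_eq h with h' | h'
  · exact hpos.not_neg h'
  · exact hne (by rw [mul_assoc]; exact h')

end Exchange

/-! ### Products of subsequences -/

section Products

variable {P : RootPairing ι ℚ V V'} {b : P.Base}

theorem ev_succ {l : ℕ} (s : Fin (l + 1) → SimpleRoot b) (σ : Fin (l + 1) → Bool) :
    ev s σ = ev (Fin.init s) (Fin.init σ) *
      if σ (Fin.last l) then simpleReflection b (s (Fin.last l)) else 1 := by
  rw [ev, List.ofFn_succ', List.concat_eq_append, List.prod_append, List.prod_singleton]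
  rfl

theorem ev_snoc {l : ℕ} (s : Fin (l + 1) → SimpleRoot b) (σ : Fin l → Bool) (t : Bool) :
    ev s (Fin.snoc (α := fun _ => Bool) σ t) = ev (Fin.init s) σ *
      if t then simpleReflection b (s (Fin.last l)) else 1 := by
  rw [ev_succ, Fin.init_snoc, Fin.snoc_last]

theorem products_init_subset {l : ℕ} (s : Fin (l + 1) → SimpleRoot b) :
    products (Fin.init s) ⊆ products s := by
  rintro _ ⟨σ, rfl⟩
  exact ⟨Fin.snoc (α := fun _ => Bool) σ false, by simp [ev_snoc]⟩

theorem mul_simpleReflection_mem_products {l : ℕ} (s : Fin (l + 1) → SimpleRoot b)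
    {x : weylGroup P} (hx : x ∈ products s) :
    x * simpleReflection b (s (Fin.last l)) ∈ products s := by
  obtain ⟨σ, rfl⟩ := hx
  refine ⟨Fin.snoc (α := fun _ => Bool) (Fin.init σ) (!σ (Fin.last l)), ?_⟩
  rw [ev_snoc, ev_succ]
  cases σ (Fin.last l) <;> simp [mul_assoc, simpleReflection_mul_self]

/-- The exchange argument deletes one factor from the subsequence representing x, which leaves
another subsequence of s; no reducedness is required. -/
theorem affineReflection_mul_mem_products [Finite ι] [P.IsRootSystem] [P.IsCrystallographic]
    [P.IsReduced] {l : ℕ} (s : Fin l → SimpleRoot b) {x : weylGroup P} (hx : x ∈ products s)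
    {γ : ι × ℤ} (hγ : IsPosRoot b γ) (h : IsPosVec b (-dualAct P x⁻¹.1 (rootVec P γ))) :
    affineReflection P γ * x ∈ products s := by
  induction l generalizing x with
  | zero =>
    obtain ⟨σ, rfl⟩ := hx
    exfalso
    refine ((isPosRoot_iff b).mp hγ).not_neg ?_
    simpa [ev, dualAct_one] using h
  | succ l ih =>
    obtain ⟨σ, rfl⟩ := hx
    rw [ev_succ] at h ⊢
    cases hσ : σ (Fin.last l) with
    | false =>
      simp only [hσ, Bool.false_eq_true, if_false, mul_one] at h ⊢
      exact products_init_subset s (ih (Fin.init s) ⟨_, rfl⟩ h)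
    | true =>
      simp only [hσ, if_true] at h ⊢
      rcases isPosVec_neg_or_mul_eq h with h' | h'
      · rw [← mul_assoc]
        exact mul_simpleReflection_mem_products s
          (products_init_subset s (ih (Fin.init s) ⟨_, rfl⟩ h'))
      · rw [h']
        exact products_init_subset s ⟨_, rfl⟩

theorem src_mem_products [Finite ι] [P.IsRootSystem] [P.IsCrystallographic]
    [P.IsReduced] [P.IsIrreducible] {l : ℕ} (s : Fin l → SimpleRoot b) (E : Edge b)
    (hE : E.1.2.1 ∈ products s) : E.1.1 ∈ products s := by
  have h := affineReflection_mul_mem_products s hE E.2.1 (by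
    rw [E.2.2.2, dualAct_inv_mul_affineReflection, neg_neg]
    exact isPosVec_of_edge E)
  rwa [E.2.2.2, ← mul_assoc, affineReflection_mul_self, one_mul] at h

end Products

end AffineWeyl

/-! ### Structure of the modules 𝒳(s) -/

namespace AffineWeyl

variable {ι V V' : Type*} [AddCommGroup V] [Module ℚ V] [AddCommGroup V'] [Module ℚ V']
  {P : RootPairing ι ℚ V V'} [P.IsCrystallographic] {b : P.Base} (F : Type*) [Field F]

section Weights

/-- The image of `x(a)` in the symmetric algebra, as an additive function of the affine weight
`a`. -/
def weightHom (x : weylGroup P) : weights P →+ Sym F P where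
  toFun a := inc F P (bar F P (act P x a))
  map_zero' := by
    have h : act P x 0 = 0 := Subtype.ext (map_zero (dualAct P x.1))
    simp [h, inc, bar]
  map_add' a a' := by
    have h : act P x (a + a') = act P x a + act P x a' := Subtype.ext (map_add (dualAct P x.1) _ _)
    simp [h, inc, bar, TensorProduct.tmul_add]

theorem weightHom_mul (x y : weylGroup P) (a : weights P) :
    weightHom F (x * y) a = weightHom F x (act P y a) := by
  have h : act P (x * y) a = act P x (act P y a) := Subtype.ext (dualAct_mul P x.1 y.1 a.1)
  exact congrArg (fun a => inc F P (bar F P a)) h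

theorem exists_act_simpleReflection (α : SimpleRoot b) (a : weights P) :
    ∃ m : ℤ, act P (simpleReflection b α) a = a - m • rootWeight P α.1 := by
  obtain ⟨m, hm⟩ := a.2.1 α.1.1
  refine ⟨m, Subtype.ext ?_⟩
  have h := dualAct_affineReflection P α.1 a.1
  have h' : P.coroot' α.1.1 a.1.1 = m := hm
  rw [h', Int.cast_smul_eq_zsmul] at h
  exact h

theorem act_simpleReflection_self (α : SimpleRoot b) :
    act P (simpleReflection b α) (rootWeight P α.1) = -rootWeight P α.1 :=
  Subtype.ext (dualAct_affineReflection_self α.1)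

theorem weightHom_mul_simpleReflection_self (x : weylGroup P) (α : SimpleRoot b) :
    weightHom F (x * simpleReflection b α) (rootWeight P α.1) =
      -weightHom F x (rootWeight P α.1) := by
  rw [weightHom_mul, act_simpleReflection_self, map_neg]

omit [P.IsCrystallographic] in
theorem exists_half [NeZero (2 : F)] : ∃ c : Sym F P, c * 2 = 1 := by
  refine ⟨algebraMap F _ 2⁻¹, ?_⟩
  rw [show (2 : Sym F P) = algebraMap F _ 2 from (map_ofNat _ 2).symm, ← map_mul,
    inv_mul_cancel₀ two_ne_zero, map_one]

end Weights

section Modules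

variable {F}

theorem weightMul_apply {l : ℕ} (s : Fin l → SimpleRoot b) (a : weights P)
    (f : (Fin l → Bool) → Sym F P) (σ : Fin l → Bool) :
    weightMul F s a f σ = weightHom F (ev s σ) a * f σ := rfl

theorem mem_X_succ {l : ℕ} {s : Fin (l + 1) → SimpleRoot b}
    {f : (Fin (l + 1) → Bool) → Sym F P} :
    f ∈ X F (l + 1) s ↔ ∃ A ∈ X F l (Fin.init s), ∃ B ∈ X F l (Fin.init s), ∀ σ,
      f σ = A (Fin.init σ) +
        weightHom F (ev s σ) (rootWeight P (s (Fin.last l)).1) * B (Fin.init σ) := by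
  rw [X, Submodule.mem_sup]
  constructor
  · rintro ⟨_, ⟨A, hA, rfl⟩, _, ⟨B, hB, rfl⟩, rfl⟩
    exact ⟨A, hA, B, hB, fun σ => rfl⟩
  · rintro ⟨A, hA, B, hB, h⟩
    exact ⟨_, ⟨A, hA, rfl⟩, _, ⟨B, hB, rfl⟩, funext fun σ => (h σ).symm⟩

theorem diag_mem {l : ℕ} {s : Fin (l + 1) → SimpleRoot b} {f : (Fin l → Bool) → Sym F P}
    (hf : f ∈ X F l (Fin.init s)) : diag F P l f ∈ X F (l + 1) s :=
  Submodule.mem_sup_left ⟨f, hf, rfl⟩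

omit [P.IsCrystallographic] in
theorem diag_apply {l : ℕ} (f : (Fin l → Bool) → Sym F P) (σ : Fin (l + 1) → Bool) :
    diag F P l f σ = f (Fin.init σ) := rfl

/-- Let d^a denote c^a formed with truncated subsequences and m = ⟨a, α^∨⟩. Whether the last entry
is kept or blank, c^a = d^a − (m/2) d^α + (m/2) c^α and (c^α)² = (d^α)². Hence c^a preserves the sum
defining 𝒳(s), as d^a and d^α preserve 𝒳(s'). -/
theorem weightMul_mem [NeZero (2 : F)] {l : ℕ} (s : Fin l → SimpleRoot b) (a : weights P)
    {f : (Fin l → Bool) → Sym F P} (hf : f ∈ X F l s) : weightMul F s a f ∈ X F l s := by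
  induction l generalizing a with
  | zero => exact Submodule.mem_top
  | succ l ih =>
    obtain ⟨A, hA, B, hB, h⟩ := mem_X_succ.mp hf
    set s' := Fin.init s
    set α := s (Fin.last l)
    obtain ⟨c, hc⟩ := exists_half F (P := P)
    obtain ⟨m, hm⟩ := exists_act_simpleReflection α a
    refine mem_X_succ.mpr ⟨weightMul F s' a A - (c * m) • weightMul F s' (rootWeight P α.1) A +
      (c * m) • weightMul F s' (rootWeight P α.1) (weightMul F s' (rootWeight P α.1) B), ?_,
      (c * m) • A + weightMul F s' a B - (c * m) • weightMul F s' (rootWeight P α.1) B, ?_, ?_⟩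
    · have h1 := ih s' a hA
      have h2 := ih s' (rootWeight P α.1) hA
      have h3 := ih s' (rootWeight P α.1) (ih s' (rootWeight P α.1) hB)
      exact add_mem (sub_mem h1 (Submodule.smul_mem _ _ h2)) (Submodule.smul_mem _ _ h3)
    · have h1 := ih s' a hB
      have h2 := ih s' (rootWeight P α.1) hB
      exact sub_mem (add_mem (Submodule.smul_mem _ _ hA) h1) (Submodule.smul_mem _ _ h2)
    · intro σ
      simp only [weightMul_apply, h, Pi.add_apply, Pi.sub_apply, Pi.smul_apply, smul_eq_mul]
      have hσ := ev_succ s σ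
      cases hl : σ (Fin.last l) with
      | false =>
        simp only [hl, Bool.false_eq_true, if_false, mul_one] at hσ
        rw [hσ]
        ring
      | true =>
        simp only [hl, if_true] at hσ
        change _ = ev s' (Fin.init σ) * simpleReflection b α at hσ
        rw [hσ, weightHom_mul_simpleReflection_self, weightHom_mul, hm, map_sub, map_zsmul,
          zsmul_eq_mul]
        set p := weightHom F (ev s' (Fin.init σ)) a
        set w := weightHom F (ev s' (Fin.init σ)) (rootWeight P α.1)
        linear_combination (m * w * (A (Fin.init σ) - w * B (Fin.init σ))) * hc

omit [P.IsCrystallographic] in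
theorem exists_ev_eq {l : ℕ} (s : Fin (l + 1) → SimpleRoot b) {x : weylGroup P}
    {σ : Fin l → Bool}
    (h : ev (Fin.init s) σ = x ∨ ev (Fin.init s) σ = x * simpleReflection b (s (Fin.last l))) :
    ∃ τ, Fin.init τ = σ ∧ ev s τ = x := by
  rcases h with h | h
  · exact ⟨Fin.snoc (α := fun _ => Bool) σ false, Fin.init_snoc .., by simp [ev_snoc, h]⟩
  · exact ⟨Fin.snoc (α := fun _ => Bool) σ true, Fin.init_snoc .., by
      simp [ev_snoc, h, mul_assoc, simpleReflection_mul_self]⟩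

omit [P.IsCrystallographic] in
theorem ev_init_eq_or {l : ℕ} (s : Fin (l + 1) → SimpleRoot b) (σ : Fin (l + 1) → Bool) :
    ev (Fin.init s) (Fin.init σ) = ev s σ ∨
      ev (Fin.init s) (Fin.init σ) = ev s σ * simpleReflection b (s (Fin.last l)) := by
  rw [ev_succ]
  cases σ (Fin.last l) <;> simp [mul_assoc, simpleReflection_mul_self]

/-- On the subsequences with product `x`, an element of `𝒳(s)` comes from an element of `𝒳(s')`. -/
theorem exists_restrict_eq {l : ℕ} {s : Fin (l + 1) → SimpleRoot b}
    {f : (Fin (l + 1) → Bool) → Sym F P} (hf : f ∈ X F (l + 1) s) (x : weylGroup P) :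
    ∃ a ∈ X F l (Fin.init s), ∀ σ, ev s σ = x → f σ = a (Fin.init σ) := by
  obtain ⟨A, hA, B, hB, h⟩ := mem_X_succ.mp hf
  refine ⟨A + weightHom F x (rootWeight P (s (Fin.last l)).1) • B,
    add_mem hA (Submodule.smul_mem _ _ hB), ?_⟩
  rintro σ rfl
  exact h σ

/-- Once the last entry is fixed, c^α becomes plus or minus the operator c^α for the truncated
sequence, which preserves 𝒳(s'). -/
theorem comp_snoc_mem [NeZero (2 : F)] {l : ℕ} {s : Fin (l + 1) → SimpleRoot b}
    {f : (Fin (l + 1) → Bool) → Sym F P} (hf : f ∈ X F (l + 1) s) (t : Bool) :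
    (fun σ => f (Fin.snoc (α := fun _ => Bool) σ t)) ∈ X F l (Fin.init s) := by
  obtain ⟨A, hA, B, hB, h⟩ := mem_X_succ.mp hf
  have hB' := weightMul_mem (Fin.init s) (rootWeight P (s (Fin.last l)).1) hB
  cases t with
  | false =>
    convert add_mem hA hB' using 1
    funext σ
    simp [h, ev_snoc, weightMul_apply]
  | true =>
    convert sub_mem hA hB' using 1
    funext σ
    simp [h, ev_snoc, weightMul_apply, weightHom_mul_simpleReflection_self]
    ring

/-- Extension by zero from the subsequences with product `z s_α` to those with product `z` or
`z s_α`. -/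
theorem exists_extension_by_zero [NeZero (2 : F)] {l : ℕ} {s : Fin l → SimpleRoot b}
    (α : SimpleRoot b) (z : weylGroup P) {v : (Fin l → Bool) → Sym F P} (hv : v ∈ X F l s) :
    ∃ k ∈ X F l s, (∀ σ, ev s σ = z → k σ = 0) ∧
      ∀ σ, ev s σ = z * simpleReflection b α →
        k σ = weightHom F z (rootWeight P α.1) * v σ := by
  obtain ⟨c, hc⟩ := exists_half F (P := P)
  -- Half of z(α) − c^α: the operator c^α is z(α) over z and −z(α) over z s_α, so the factor is 0
  -- over z and z(α) over z s_α.
  refine ⟨c • (weightHom F z (rootWeight P α.1) • v - weightMul F s (rootWeight P α.1) v),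
    Submodule.smul_mem _ _ (sub_mem (Submodule.smul_mem _ _ hv) (weightMul_mem s _ hv)), ?_, ?_⟩
  · intro σ hσ
    simp [weightMul_apply, hσ]
  · intro σ hσ
    simp only [Pi.smul_apply, Pi.sub_apply, weightMul_apply, hσ, smul_eq_mul,
      weightHom_mul_simpleReflection_self]
    linear_combination (weightHom F z (rootWeight P α.1) * v σ) * hc

end Modules

/-! ### The simultaneous induction -/

section Main

/-- The label of an edge of the moment graph. -/
def edgeLabel (E : Edge b) : WeightSpace F P := bar F P (rootWeight P E.1.2.2)

/-- Elements of `𝒳(s)` vanishing at the source of an edge are divisible at its target by the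
label. -/
def DivisibleAlongEdges {l : ℕ} (s : Fin l → SimpleRoot b) : Prop :=
  ∀ E : Edge b, ∀ f ∈ X F l s, (∀ σ, ev s σ = E.1.1 → f σ = 0) →
    ∃ g ∈ X F l s, ∀ σ, ev s σ = E.1.2.1 → f σ = inc F P (edgeLabel F E) * g σ

/-- Linearly independent weights `γ, β` form regular sequences on the restrictions of `𝒳(s)` to the
subsequences with a given product. -/
def RegularOnStalks {l : ℕ} (s : Fin l → SimpleRoot b) : Prop :=
  ∀ (x : weylGroup P) (β γ : WeightSpace F P), LinearIndependent F ![β, γ] →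
    ∀ t ∈ X F l s, ∀ u ∈ X F l s, (∀ σ, ev s σ = x → inc F P β * t σ = inc F P γ * u σ) →
      ∃ v ∈ X F l s, ∀ σ, ev s σ = x → t σ = inc F P γ * v σ

variable {F}

theorem inc_edgeLabel {E : Edge b} {α : SimpleRoot b}
    (h : rootWeight P E.1.2.2 = act P E.1.1 (rootWeight P α.1)) :
    inc F P (edgeLabel F E) = weightHom F E.1.1 (rootWeight P α.1) := by
  rw [edgeLabel, h]
  rfl

theorem edgeLabel_ne_zero [NeZero (2 : F)] (E : Edge b) : edgeLabel F E ≠ 0 := bar_rootWeight_ne_zero F _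

theorem gkm_full_mono [NeZero (2 : F)] {I J : Set (weylGroup P)} (hIJ : I ⊆ J)
    (hG : ((momentGraph F b).full J).GKM) : ((momentGraph F b).full I).GKM := by
  rintro ⟨E, h1, h2⟩ ⟨E', h1', h2'⟩ hne ⟨⟨x, hx⟩, hxE, hxE'⟩
  refine hG ⟨E, hIJ h1, hIJ h2⟩ ⟨E', hIJ h1', hIJ h2'⟩
    (fun h => hne (Subtype.ext (congrArg Subtype.val h :)))
    ⟨⟨x, hIJ hx⟩, ?_, ?_⟩
  · rcases hxE with h | h
    exacts [Or.inl (Subtype.ext (congrArg Subtype.val h :)),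
      Or.inr (Subtype.ext (congrArg Subtype.val h :))]
  · rcases hxE' with h | h
    exacts [Or.inl (Subtype.ext (congrArg Subtype.val h :)),
      Or.inr (Subtype.ext (congrArg Subtype.val h :))]

theorem linearIndependent_edgeLabel [NeZero (2 : F)] {I : Set (weylGroup P)} (hG : ((momentGraph F b).full I).GKM)
    {E E' : Edge b} (hne : E ≠ E') (h1 : E.1.1 ∈ I) (h2 : E.1.2.1 ∈ I) (h1' : E'.1.1 ∈ I)
    (h2' : E'.1.2.1 ∈ I) (hx : E.1.1 = E'.1.2.1 ∨ E.1.2.1 = E'.1.2.1) :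
    LinearIndependent F ![edgeLabel F E, edgeLabel F E'] := by
  rw [LinearIndependent.pair_iff' (edgeLabel_ne_zero E)]
  intro a ha
  refine hG ⟨E, h1, h2⟩ ⟨E', h1', h2'⟩ (fun h => hne (congrArg Subtype.val h))
    ⟨⟨E'.1.2.1, h2'⟩, ?_, Or.inr rfl⟩ (Submodule.mem_span_singleton.mpr ⟨a, ha⟩)
  exact hx.imp (fun h => Subtype.ext h.symm) (fun h => Subtype.ext h.symm)

theorem regularOnStalks_zero (s : Fin 0 → SimpleRoot b) : RegularOnStalks F s := by
  intro x β γ h t _ u _ htu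
  by_cases hx : ev s default = x
  · obtain ⟨v, hv⟩ := SymmetricAlgebra.exists_eq_mul_of_linearIndependent h (htu default hx)
    refine ⟨fun _ => v, Submodule.mem_top, fun σ _ => ?_⟩
    rw [Subsingleton.elim σ default]
    exact hv
  · refine ⟨0, zero_mem _, fun σ hσ => absurd ?_ hx⟩
    rwa [Subsingleton.elim default σ]

variable [Finite ι] [P.IsRootSystem] [P.IsReduced] [P.IsIrreducible]

/-- Vacuous: the empty sequence has a single product, and an edge ending there would also have to
start there. -/
theorem divisibleAlongEdges_zero (s : Fin 0 → SimpleRoot b) : DivisibleAlongEdges F s := by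
  intro E f _ _
  refine ⟨0, zero_mem _, fun σ hσ => ?_⟩
  have h1 := src_mem_products s E ⟨σ, hσ⟩
  obtain ⟨τ, hτ⟩ := h1
  have h2 : E.1.1 = E.1.2.1 := by rw [← hσ, ← hτ, Subsingleton.elim σ τ]
  exact absurd (h2 ▸ E.2.2.1) (@lt_irrefl _ (bruhatOrder b).toPreorder _)

variable [NeZero (2 : F)]

theorem regularOnStalks_succ {l : ℕ} {s : Fin (l + 1) → SimpleRoot b}
    (hC : DivisibleAlongEdges F (Fin.init s)) (hR : RegularOnStalks F (Fin.init s)) :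
    RegularOnStalks F s := by
  intro x β γ hβγ t ht u hu htu
  obtain ⟨E, hEx, hE2, hE⟩ := exists_edge_mul_simpleReflection x (s (Fin.last l))
  have hlab := inc_edgeLabel (F := F) hE
  have hne : inc F P (edgeLabel F E) ≠ 0 := SymmetricAlgebra.ι_ne_zero (edgeLabel_ne_zero E)
  obtain ⟨t', ht', htt'⟩ := exists_restrict_eq ht x
  obtain ⟨u', hu', huu'⟩ := exists_restrict_eq hu x
  set α := s (Fin.last l) with hα
  have hss : E.1.2.1 * simpleReflection b α = E.1.1 := by
    rw [hE2, mul_assoc, simpleReflection_mul_self, mul_one]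
  have hpair : ∀ y, (y = E.1.1 ∨ y = E.1.2.1) ↔ (y = x ∨ y = x * simpleReflection b α) := by
    intro y
    rcases hEx with h | h
    · rw [hE2, h]
    · rw [hE2, h, mul_assoc, simpleReflection_mul_self, mul_one, or_comm]
  have htu' : ∀ σ, (ev (Fin.init s) σ = E.1.1 ∨ ev (Fin.init s) σ = E.1.2.1) →
      inc F P β * t' σ = inc F P γ * u' σ := by
    intro σ hσ
    obtain ⟨τ, rfl, hτ⟩ := exists_ev_eq s ((hpair _).mp hσ)
    rw [← htt' τ hτ, ← huu' τ hτ, htu τ hτ]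
  -- Solve at the source first. The errors t' − γv₁ and u' − βv₁ vanish there, so at the target they
  -- are label multiples of `p` and `q`; cancelling the label gives βp = γq, to which regularity
  -- applies again.
  obtain ⟨v₁, hv₁, hv₁'⟩ := hR E.1.1 β γ hβγ t' ht' u' hu' fun σ hσ => htu' σ (Or.inl hσ)
  have hγ : inc F P γ ≠ 0 := SymmetricAlgebra.ι_ne_zero (hβγ.ne_zero 1)
  obtain ⟨p, hp, hp'⟩ := hC E (t' - inc F P γ • v₁) (sub_mem ht' (Submodule.smul_mem _ _ hv₁))
    fun σ hσ => by simp [hv₁' σ hσ]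
  obtain ⟨q, hq, hq'⟩ := hC E (u' - inc F P β • v₁) (sub_mem hu' (Submodule.smul_mem _ _ hv₁))
    fun σ hσ => by
      have h1 := htu' σ (Or.inl hσ)
      rw [hv₁' σ hσ] at h1
      refine mul_left_cancel₀ hγ ?_
      simp only [Pi.sub_apply, Pi.smul_apply, smul_eq_mul]
      linear_combination -h1
  obtain ⟨v₂, hv₂, hv₂'⟩ := hR E.1.2.1 β γ hβγ p hp q hq fun σ hσ => by
    have h1 := htu' σ (Or.inr hσ)
    have h2 := hp' σ hσ
    have h3 := hq' σ hσ
    simp only [Pi.sub_apply, Pi.smul_apply, smul_eq_mul] at h2 h3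
    refine mul_left_cancel₀ hne ?_
    linear_combination h1 - inc F P β * h2 + inc F P γ * h3
  obtain ⟨k, hk, hk0, hk1⟩ := exists_extension_by_zero α E.1.1 hv₂
  refine ⟨diag F P l (v₁ + k), diag_mem (add_mem hv₁ hk), ?_⟩
  rintro σ rfl
  rw [htt' σ rfl, diag_apply, Pi.add_apply]
  rcases (hpair _).mpr (ev_init_eq_or s σ) with h | h
  · rw [hk0 _ h, add_zero, hv₁' _ h]
  · have h2 := hp' _ h
    simp only [Pi.sub_apply, Pi.smul_apply, smul_eq_mul] at h2
    rw [hk1 _ (h.trans hE2), ← hlab]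
    linear_combination h2 + inc F P (edgeLabel F E) * hv₂' _ h

theorem divisibleAlongEdges_succ {l : ℕ} {s : Fin (l + 1) → SimpleRoot b}
    (hG : ((momentGraph F b).full (products s)).GKM)
    (hC : DivisibleAlongEdges F (Fin.init s)) (hR : RegularOnStalks F (Fin.init s)) :
    DivisibleAlongEdges F s := by
  intro E f hf hfy
  set α := s (Fin.last l) with hα
  by_cases hyx : E.1.2.1 * simpleReflection b α = E.1.1
  · have hxy : E.1.2.1 = E.1.1 * simpleReflection b α := by
      rw [← hyx, mul_assoc, simpleReflection_mul_self, mul_one]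
    rw [inc_edgeLabel (rootWeight_of_edge_mul_simpleReflection E α hxy)]
    obtain ⟨A, hA, B, hB, h⟩ := mem_X_succ.mp hf
    -- Vanishing over y gives A = −y(α)B on truncations; over x = y s_α the element is A − y(α)B =
    -- −2y(α)B.
    refine ⟨diag F P l ((-2 : Sym F P) • B), diag_mem (Submodule.smul_mem _ _ hB), ?_⟩
    intro σ hσ
    obtain ⟨τ, hτσ, hτ⟩ := exists_ev_eq s (x := E.1.1) (σ := Fin.init σ) (by
      rw [or_comm, ← hα, ← hxy, ← hσ]
      have := ev_init_eq_or s σ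
      rwa [← hα, hσ, hyx, ← hσ] at this)
    have h0 := hfy τ hτ
    rw [h, hτ, hτσ] at h0
    rw [h, hσ, hxy, weightHom_mul_simpleReflection_self, diag_apply, Pi.smul_apply, smul_eq_mul]
    linear_combination h0
  by_cases hx : E.1.2.1 ∈ products s
  swap
  · exact ⟨0, zero_mem _, fun σ hσ => absurd ⟨σ, hσ⟩ hx⟩
  set x := E.1.2.1 with hxdef
  obtain ⟨E₀, hEx, hE2, hE⟩ := exists_edge_mul_simpleReflection x α
  have hlab := inc_edgeLabel (F := F) hE
  have hpair : ∀ y, (y = E₀.1.1 ∨ y = E₀.1.2.1) ↔ (y = x ∨ y = x * simpleReflection b α) := by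
    intro y
    rcases hEx with h | h
    · rw [hE2, h]
    · rw [hE2, h, mul_assoc, simpleReflection_mul_self, mul_one, or_comm]
  have hxs : x * simpleReflection b α ∈ products s := mul_simpleReflection_mem_products s hx
  have hmem : ∀ y, (y = E₀.1.1 ∨ y = E₀.1.2.1) → y ∈ products s := by
    intro y hy
    rcases (hpair y).mp hy with rfl | rfl
    · exact hx
    · exact hxs
  -- The GKM-property enters here: E₀ and E are distinct edges meeting at x, and all their vertices
  -- are products of subsequences.
  have hli := linearIndependent_edgeLabel hG (E := E₀) (E' := E)
    (by
      rintro rfl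
      apply hyx
      rw [hxdef, hE2, mul_assoc, simpleReflection_mul_self, mul_one])
    (hmem _ (Or.inl rfl)) (hmem _ (Or.inr rfl)) (src_mem_products s E hx) hx
    (((hpair x).mpr (Or.inl rfl)).imp Eq.symm Eq.symm)
  obtain ⟨a, ha, haf⟩ := exists_restrict_eq hf x
  -- divisibility at `x` and at `x s` separately
  have hdiv : ∀ y, (y = E₀.1.1 ∨ y = E₀.1.2.1) → ∃ u ∈ X F l (Fin.init s),
      ∀ σ, ev (Fin.init s) σ = y → a σ = inc F P (edgeLabel F E) * u σ := by
    intro y hy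
    rcases (hpair y).mp hy with rfl | rfl
    · obtain ⟨u, hu, hu'⟩ := hC E _ (comp_snoc_mem hf false) fun σ hσ =>
        hfy _ (by simp [ev_snoc, hσ])
      refine ⟨u, hu, fun σ hσ => ?_⟩
      rw [← hu' σ hσ, haf _ (by simp [ev_snoc, hσ]), Fin.init_snoc]
    · obtain ⟨E₁, hE₁⟩ := exists_edge_mul_right E α hyx
      obtain ⟨u, hu, hu'⟩ := hC E₁ _ (comp_snoc_mem hf true) fun σ hσ =>
        hfy _ (by simp [ev_snoc, hσ, hE₁, mul_assoc, ← hα, simpleReflection_mul_self])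
      refine ⟨u, hu, fun σ hσ => ?_⟩
      have h1 := hu' σ (by rw [hσ, hE₁])
      have h2 : edgeLabel F E₁ = edgeLabel F E := by rw [edgeLabel, hE₁, edgeLabel]
      rw [← h2, ← h1, haf _ (by
        simp [ev_snoc, hσ, mul_assoc, ← hα, simpleReflection_mul_self]), Fin.init_snoc]
  -- The quotient `u` is right at the source of E₀ and `v` at its target. There a − γu equals both
  -- λt and γ(v − u), so t = γr by regularity, and extending λr by zero gives the correction `k` to
  -- `u`.
  obtain ⟨u, hu, hu'⟩ := hdiv _ (Or.inl rfl)
  obtain ⟨v, hv, hv'⟩ := hdiv _ (Or.inr rfl)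
  obtain ⟨t, ht, ht'⟩ := hC E₀ (a - inc F P (edgeLabel F E) • u)
    (sub_mem ha (Submodule.smul_mem _ _ hu)) fun σ hσ => by simp [hu' σ hσ]
  simp only [Pi.sub_apply, Pi.smul_apply, smul_eq_mul] at ht'
  obtain ⟨r, hr, hr'⟩ := hR E₀.1.2.1 _ _ hli t ht (v - u) (sub_mem hv hu) fun σ hσ => by
    rw [← ht' σ hσ, hv' σ hσ, Pi.sub_apply, mul_sub]
  obtain ⟨k, hk, hk0, hk1⟩ := exists_extension_by_zero α E₀.1.1 hr
  refine ⟨diag F P l (u + k), diag_mem (add_mem hu hk), ?_⟩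
  intro σ hσ
  rw [haf σ hσ, diag_apply, Pi.add_apply]
  rcases (hpair _).mpr (hσ ▸ ev_init_eq_or s σ) with h | h
  · rw [hk0 _ h, add_zero, hu' _ h]
  · rw [hk1 _ (h.trans hE2), ← hlab]
    linear_combination ht' _ h + inc F P (edgeLabel F E₀) * hr' _ h

theorem divisibleAlongEdges_and_regularOnStalks {l : ℕ} (s : Fin l → SimpleRoot b)
    (hG : ((momentGraph F b).full (products s)).GKM) :
    DivisibleAlongEdges F s ∧ RegularOnStalks F s := by
  induction l with
  | zero => exact ⟨divisibleAlongEdges_zero s, regularOnStalks_zero s⟩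
  | succ l ih =>
    obtain ⟨hC, hR⟩ := ih (Fin.init s) (gkm_full_mono (products_init_subset s) hG)
    exact ⟨divisibleAlongEdges_succ hG hC hR, regularOnStalks_succ hC hR⟩

end Main

end AffineWeyl

end

theorem corollary3 {ι V V' : Type*} [Finite ι] [AddCommGroup V] [Module ℚ V] [AddCommGroup V']
    [Module ℚ V'] {P : RootPairing ι ℚ V V'} [P.IsRootSystem] [P.IsCrystallographic] [P.IsReduced]
    [P.IsIrreducible] (b : P.Base) (F : Type*) [Field F] [NeZero (2 : F)] {l : ℕ}
    (s : Fin l → AffineWeyl.SimpleRoot b)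
    (hGKM : ((AffineWeyl.momentGraph F b).full (AffineWeyl.products s)).GKM)
    (E : AffineWeyl.Edge b) (y x : AffineWeyl.weylGroup P) (α : AffineWeyl.WeightSpace F P)
    (hy : (AffineWeyl.momentGraph F b).src E = y) (hx : (AffineWeyl.momentGraph F b).tgt E = x)
    (hα : (AffineWeyl.momentGraph F b).label E = α)
    (f : (Fin l → Bool) → AffineWeyl.Sym F P) (hf : f ∈ AffineWeyl.X F l s)
    (hfy : (AffineWeyl.subseqs s y).domRestrict f = 0) :
    ∃ g ∈ AffineWeyl.X F l s, (AffineWeyl.subseqs s x).domRestrict f =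
      AffineWeyl.inc F P α • (AffineWeyl.subseqs s x).domRestrict g := by
  subst hy hx hα
  obtain ⟨g, hg, hfg⟩ := (AffineWeyl.divisibleAlongEdges_and_regularOnStalks s hGKM).1 E f hf
    fun σ hσ => congrFun hfy ⟨σ, hσ⟩
  exact ⟨g, hg, funext fun σ => hfg σ.1 σ.2⟩
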